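/- Let $\mathbb{CP}^2$ carry its standard complex structure $J$ and its standard (flat) complex projective structure, i.e. the class of the Levi-Civita connection of the Fubini–Study metric under the relation that identifies two torsion-free complex-linear connections with the same generalised geodesics. (A generalised geodesic of $\nabla$ is a smoothly immersed curve $\gamma$ with $\nabla_{\dot\gamma}\dot\gamma\wedge\dot\gamma\wedge J\dot\gamma=0$.) A (pseudo-)Kähler metric on an open set $U$ is a smooth, symmetric, nondegenerate, $J$-invariant bilinear form of any signature on $TU$ whose Levi-Civita connection satisfies $\nabla J=0$; it is called compatible if its Levi-Civita connection belongs to the standard complex projective structure on $U$. For a hermitian $3\times 3$ matrix $C$ and $v\in\mathbb{C}^3\setminus\{0\}$ put $\Delta_C(v)=v^*\operatorname{adj}(C)\,v\in\mathbb{R}$ and $D_C=\{[v]\in\mathbb{CP}^2 : \Delta_C(v)\neq 0\}$. On $D_C$ let $g_C$ be the bilinear form $$ g_C|_{[v]}\big(d\pi_v(w),d\pi_v(w')\big)=\operatorname{Re}\,\frac{-(v\times w)^{t}\,C\,\overline{(v\times w')}}{\Delta_C(v)^2},\qquad w,w'\in\mathbb{C}^3, $$ where $\pi:\mathbb{C}^3\setminus\{0\}\to\mathbb{CP}^2$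 is the projection and $\times$ is the complex bilinear cross product. Let $U\subset\mathbb{CP}^2$ be a domain (a nonempty connected open set). Then $C\mapsto g_C|_U$ is a one-to-one correspondence between the hermitian forms $C$ on $\mathbb{C}^3$ of rank at least two with $U\subset D_C$ and the (pseudo-)Kähler metrics on $U$ that are compatible with the standard complex projective structure. That is: 1. if $C$ is hermitian of rank at least two and $U\subset D_C$, then $g_C$ is a compatible (pseudo-)Kähler metric on $U$; 2. for every compatible (pseudo-)Kähler metric $g$ on $U$ there is exactly one hermitian $C$ of rank at least two such that $U\subset D_C$ and $g=g_C$ on $U$. Moreover, every hermitian form of rank at least two occurs on some domain: 3. if $C$ is hermitian of rank at least two, there is a domain $V\subset U\cap D_C$. -/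

import Mathlib

open scoped Manifold ContDiff Matrix LinearAlgebra.Projectivization

noncomputable section

namespace CProj

/-! ### The complex projective plane as a complex manifold -/

/-- The coordinate space `ℂ²`. -/
abbrev C2 : Type := Fin 2 → ℂ

/-- The space `ℂ³` of homogeneous coordinates. -/
abbrev C3 : Type := Fin 3 → ℂ

/-- The complex projective plane: the complex lines through the origin of `ℂ³`. -/
abbrev CP2 : Type := ℙ ℂ C3

/-- The quotient topology of `ℂ³ ∖ {0}`. -/
instance : TopologicalSpace CP2 :=
  inferInstanceAs (TopologicalSpace (Quotient (projectivizationSetoid ℂ C3)))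

/-- `(z¹, z²) ↦ (z¹, z²)` with a `1` inserted at the `k`-th place. -/
def homog (k : Fin 3) (z : C2) : C3 := k.insertNth (1 : ℂ) z

theorem homog_self (k : Fin 3) (z : C2) : homog k z k = 1 := by
  simp [homog]

theorem homog_succAbove (k : Fin 3) (z : C2) (i : Fin 2) : homog k z (k.succAbove i) = z i := by
  simp [homog]

theorem homog_ne_zero (k : Fin 3) (z : C2) : homog k z ≠ 0 := fun h => by
  simpa [homog_self] using congrFun h k

theorem exists_rep_eq (v : C3) (hv : v ≠ 0) :
    ∃ a : ℂ, a ≠ 0 ∧ (Projectivization.mk ℂ v hv).rep = a • v := by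
  obtain ⟨a, ha⟩ := Projectivization.exists_smul_eq_mk_rep ℂ v hv
  exact ⟨a, a.ne_zero, by rw [← ha]; rfl⟩

theorem isQuotientMap_mk : Topology.IsQuotientMap (Projectivization.mk' ℂ : {v : C3 // v ≠ 0} → CP2) :=
  isQuotientMap_quotient_mk'

theorem isOpen_affine (k : Fin 3) : IsOpen {p : CP2 | p.rep k ≠ 0} := by
  rw [← isQuotientMap_mk.isOpen_preimage]
  have : (Projectivization.mk' ℂ : {v : C3 // v ≠ 0} → CP2) ⁻¹' {p : CP2 | p.rep k ≠ 0}
      = {v | v.1 k ≠ 0} := by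
    ext v
    obtain ⟨a, ha, h⟩ := exists_rep_eq v.1 v.2
    simp [h, ha]
  rw [this]
  exact isOpen_ne.preimage ((continuous_apply k).comp continuous_subtype_val)

/-- The `k`-th affine chart `[v] ↦ (vⁱ / vᵏ)_{i ≠ k}` of `ℂP²`, defined where `vᵏ ≠ 0`; its inverse
is `z ↦ [homog k z]`. -/
def affineChart (k : Fin 3) : OpenPartialHomeomorph CP2 C2 where
  toFun p := fun i => p.rep (k.succAbove i) / p.rep k
  invFun z := Projectivization.mk ℂ (homog k z) (homog_ne_zero k z)
  source := {p | p.rep k ≠ 0}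
  target := Set.univ
  map_source' _ _ := Set.mem_univ _
  map_target' z _ := by
    obtain ⟨a, ha, h⟩ := exists_rep_eq (homog k z) (homog_ne_zero k z)
    simp [h, ha, homog_self]
  left_inv' p hp := by
    have hp' : p.rep k ≠ 0 := hp
    conv_rhs => rw [← p.mk_rep]
    rw [Projectivization.mk_eq_mk_iff']
    refine ⟨(p.rep k)⁻¹, ?_⟩
    ext j
    rcases Fin.eq_self_or_eq_succAbove k j with rfl | ⟨i, rfl⟩
    · simp [homog_self, hp']
    · simp [homog_succAbove, div_eq_inv_mul]
  right_inv' z _ := by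
    obtain ⟨a, ha, h⟩ := exists_rep_eq (homog k z) (homog_ne_zero k z)
    ext i
    simp [h, ha, homog_self, homog_succAbove]
  open_source := isOpen_affine k
  open_target := isOpen_univ
  continuousOn_toFun := by
    rw [isQuotientMap_mk.continuousOn_isOpen_iff (isOpen_affine k)]
    have : ContinuousOn (fun v : {v : C3 // v ≠ 0} => fun i : Fin 2 => v.1 (k.succAbove i) / v.1 k)
        ((Projectivization.mk' ℂ : {v : C3 // v ≠ 0} → CP2) ⁻¹' {p : CP2 | p.rep k ≠ 0}) := by
      refine continuousOn_pi.2 fun i => ContinuousOn.div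
        ((continuous_apply _).comp continuous_subtype_val).continuousOn
        ((continuous_apply _).comp continuous_subtype_val).continuousOn ?_
      intro v hv
      obtain ⟨a, ha, h⟩ := exists_rep_eq v.1 v.2
      simpa [h, ha] using hv
    refine this.congr ?_
    intro v hv
    obtain ⟨a, ha, h⟩ := exists_rep_eq v.1 v.2
    ext i
    simp only [Function.comp, Projectivization.mk'_eq_mk, h, Pi.smul_apply, smul_eq_mul]
    exact mul_div_mul_left _ _ ha
  continuousOn_invFun := by
    refine Continuous.continuousOn ?_
    have h1 : Continuous (fun z : C2 => (⟨homog k z, homog_ne_zero k z⟩ : {v : C3 // v ≠ 0})) := by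
      refine Continuous.subtype_mk ?_ _
      refine continuous_pi fun j => ?_
      rcases Fin.eq_self_or_eq_succAbove k j with rfl | ⟨i, rfl⟩
      · simpa only [homog_self] using continuous_const
      · simpa only [homog_succAbove] using continuous_apply i
    exact isQuotientMap_mk.continuous.comp h1

theorem exists_index (p : CP2) : ∃ k, p.rep k ≠ 0 := by
  by_contra! h
  exact p.rep_nonzero (funext h)

/-- The index of the preferred affine chart around `p`. -/
def index (p : CP2) : Fin 3 := (exists_index p).choose

theorem rep_index_ne_zero (p : CP2) : p.rep (index p) ≠ 0 := (exists_index p).choose_spec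

instance : ChartedSpace C2 CP2 where
  atlas := Set.range affineChart
  chartAt p := affineChart (index p)
  mem_chart_source p := rep_index_ne_zero p
  chart_mem_atlas p := ⟨index p, rfl⟩

theorem contDiffOn_transition (k l : Fin 3) :
    ContDiffOn ℂ ω ((affineChart k).symm ≫ₕ affineChart l)
      ((affineChart k).symm ≫ₕ affineChart l).source := by
  have hh : ∀ j, ContDiff ℂ ω (fun z : C2 => homog k z j) := by
    intro j
    rcases Fin.eq_self_or_eq_succAbove k j with rfl | ⟨i, rfl⟩
    · simpa only [homog_self] using contDiff_const
    · simpa only [homog_succAbove] using contDiff_apply ℂ ℂ i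
  have key : ContDiffOn ℂ ω (fun z : C2 => fun i : Fin 2 => homog k z (l.succAbove i) / homog k z l)
      {z | homog k z l ≠ 0} :=
    contDiffOn_pi.2 fun i => (hh _).contDiffOn.div (hh _).contDiffOn fun z hz => hz
  refine (key.congr ?_).mono ?_
  · intro z _
    obtain ⟨a, ha, h⟩ := exists_rep_eq (homog k z) (homog_ne_zero k z)
    ext i
    change (Projectivization.mk ℂ (homog k z) _).rep _
      / (Projectivization.mk ℂ (homog k z) _).rep _ = _
    rw [h]
    exact mul_div_mul_left _ _ ha
  · intro z hz
    obtain ⟨a, ha, h⟩ := exists_rep_eq (homog k z) (homog_ne_zero k z)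
    have hz' : (Projectivization.mk ℂ (homog k z) (homog_ne_zero k z)).rep l ≠ 0 := hz.2
    rw [h] at hz'
    exact right_ne_zero_of_mul hz'

/-- The affine charts make `ℂP²` a complex manifold. -/
instance : IsManifold 𝓘(ℂ, C2) ω CP2 := by
  refine isManifold_of_contDiffOn _ _ _ ?_
  rintro _ _ ⟨k, rfl⟩ ⟨l, rfl⟩
  simpa using! contDiffOn_transition k l

/-- The underlying smooth real manifold. -/
instance : IsManifold 𝓘(ℝ, C2) ∞ CP2 := by
  refine isManifold_of_contDiffOn _ _ _ ?_
  rintro _ _ ⟨k, rfl⟩ ⟨l, rfl⟩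
  simpa using! ((contDiffOn_transition k l).restrict_scalars ℝ).of_le le_top

/-! ### Hermitian metrics, Levi-Civita connections, generalised geodesics -/

/-- The real tangent space `T_p ℂP²`. In Mathlib it is by definition a copy of the model space `ℂ²`,
the identification being the derivative of the preferred affine chart at `p`. -/
abbrev Tan (p : CP2) : Type := TangentSpace 𝓘(ℝ, C2) p

/-- The complex structure `J` of `ℂP²`. -/
def J {p : CP2} (u : Tan p) : Tan p := (Complex.I • (show C2 from u) : C2)

/-- A field of real bilinear forms on the tangent spaces of `ℂP²`. Only its values over the domain
under consideration matter. -/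
abbrev BilinField : Type := ∀ p : CP2, LinearMap.BilinForm ℝ (Tan p)

/-- The points of `ℂ²` that the inverse of the `k`-th affine chart maps into `U`. -/
def coordDomain (U : Set CP2) (k : Fin 3) : Set C2 := (affineChart k).symm ⁻¹' U

/-- The expression of a field of bilinear forms in the `k`-th affine chart. -/
def BilinField.inChart (g : BilinField) (k : Fin 3) (z u w : C2) : ℝ :=
  g ((affineChart k).symm z)
    (mfderiv 𝓘(ℝ, C2) 𝓘(ℝ, C2) (affineChart k).symm z u)
    (mfderiv 𝓘(ℝ, C2) 𝓘(ℝ, C2) (affineChart k).symm z w)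

/-- An affine connection, given in each affine chart by its Christoffel map `Γ k z : ℂ² × ℂ² → ℂ²`,
so that `∇_u W = D_u W + Γ k z u W` for vector fields `W` in the coordinates of that chart. -/
abbrev Christoffel : Type := Fin 3 → C2 → C2 → C2 → C2

/-- The Levi-Civita connection of `g`: at points where `g` is nondegenerate, `Γ u w` is the unique
vector `a` with
`g(a, y) = (D_u g(w, y) + D_w g(u, y) - D_y g(u, w)) / 2` for all `y`. -/
def leviCivita (g : BilinField) : Christoffel := fun k z u w =>
  Classical.epsilon fun a : C2 => ∀ y : C2, g.inChart k z a y =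
    (fderiv ℝ (fun x => g.inChart k x w y) z u + fderiv ℝ (fun x => g.inChart k x u y) z w
      - fderiv ℝ (fun x => g.inChart k x u w) z y) / 2

/-- The connection is complex-linear on `U`, i.e. `∇J = 0`. -/
def IsComplexLinear (Γ : Christoffel) (U : Set CP2) : Prop :=
  ∀ k, ∀ z ∈ coordDomain U k, ∀ u w : C2, Γ k z u (Complex.I • w) = Complex.I • Γ k z u w

/-- `g` is a (pseudo-)Kähler metric on the open set `U`: a smooth nondegenerate symmetric
`J`-invariant bilinear form, of any signature, whose Levi-Civita connection is complex-linear. -/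
structure IsPseudoKahler (g : BilinField) (U : Set CP2) : Prop where
  smooth : ∀ k, ∀ u w : C2, ContDiffOn ℝ ∞ (fun z => g.inChart k z u w) (coordDomain U k)
  symm : ∀ p ∈ U, ∀ u w : Tan p, g p u w = g p w u
  nondegenerate : ∀ p ∈ U, ∀ u : Tan p, (∀ w : Tan p, g p u w = 0) → u = 0
  hermitian : ∀ p ∈ U, ∀ u w : Tan p, g p (J u) (J w) = g p u w
  parallel : IsComplexLinear (leviCivita g) U

/-- `γ : I → ℂP²` is a generalised geodesic of `Γ`: a smoothly immersed curve whose covariant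
acceleration `∇_γ' γ'` lies in the plane spanned by `γ'` and `Jγ'`, i.e. is a complex multiple
of `γ'`. -/
structure IsGeneralisedGeodesic (Γ : Christoffel) (I : Set ℝ) (γ : ℝ → CP2) : Prop where
  smooth : ContMDiffOn 𝓘(ℝ, ℝ) 𝓘(ℝ, C2) ∞ γ I
  immersed : ∀ t ∈ I, ∀ k, γ t ∈ (affineChart k).source → deriv (affineChart k ∘ γ) t ≠ 0
  planar : ∀ t ∈ I, ∀ k, γ t ∈ (affineChart k).source → ∃ c : ℂ,
    deriv (deriv (affineChart k ∘ γ)) t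
      + Γ k (affineChart k (γ t)) (deriv (affineChart k ∘ γ) t) (deriv (affineChart k ∘ γ) t)
      = c • deriv (affineChart k ∘ γ) t

/-- Two connections are complex projectively equivalent on `U` if they have the same generalised
geodesics in `U`; curves are parametrised by open intervals. -/
def ComplexProjectivelyEquivalent (Γ Γ' : Christoffel) (U : Set CP2) : Prop :=
  ∀ (I : Set ℝ) (γ : ℝ → CP2), IsOpen I → I.OrdConnected → Set.MapsTo γ I U →
    (IsGeneralisedGeodesic Γ I γ ↔ IsGeneralisedGeodesic Γ' I γ)

/-! ### The standard structure and the metrics of hermitian forms -/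

/-- The homogeneous coordinates of `p` normalised in the preferred affine chart. -/
def point (p : CP2) : C3 := homog (index p) (affineChart (index p) p)

/-- `u` with a `0` inserted at the `k`-th place: the derivative of `homog k` in the direction `u`. -/
def direction (k : Fin 3) (u : C2) : C3 := k.insertNth (0 : ℂ) u

theorem direction_add (k : Fin 3) (u w : C2) :
    direction k (u + w) = direction k u + direction k w := by
  ext j
  rcases Fin.eq_self_or_eq_succAbove k j with rfl | ⟨i, rfl⟩ <;> simp [direction]

theorem direction_smul (k : Fin 3) (c : ℝ) (u : C2) :
    direction k (c • u) = (c : ℂ) • direction k u := by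
  ext j
  rcases Fin.eq_self_or_eq_succAbove k j with rfl | ⟨i, rfl⟩ <;> simp [direction]

/-- The representative in `ℂ³` of a tangent vector at `p`: the differential of the projection
`ℂ³ ∖ {0} → ℂP²` at `point p` maps `lift u` to `u`. -/
def lift {p : CP2} (u : Tan p) : C3 := direction (index p) u

theorem lift_add {p : CP2} (u w : Tan p) : lift (u + w) = lift u + lift w :=
  direction_add (index p) u w

theorem lift_smul {p : CP2} (c : ℝ) (u : Tan p) : lift (c • u) = (c : ℂ) • lift u :=
  direction_smul (index p) c u

/-- The standard hermitian product `Σ vⁱ w̄ⁱ` of `ℂ³`. -/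
def herm (v w : C3) : ℂ := v ⬝ᵥ star w

/-- The Fubini–Study metric: the real part of
`(⟨v, v⟩ ⟨w, w'⟩ - ⟨w, v⟩ ⟨v, w'⟩) / ⟨v, v⟩²`
at `[v]` on the tangent vectors represented by `w` and `w'`. -/
def fubiniStudy : BilinField := fun p =>
  LinearMap.mk₂ ℝ
    (fun u u' => ((herm (point p) (point p) * herm (lift u) (lift u')
      - herm (lift u) (point p) * herm (point p) (lift u')) / herm (point p) (point p) ^ 2).re)
    (fun u₁ u₂ w => by
      rw [← Complex.add_re]; congr 1; simp only [herm, lift_add, add_dotProduct]; ring)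
    (fun c u w => by
      rw [smul_eq_mul, ← Complex.re_ofReal_mul]; congr 1
      simp only [herm, lift_smul, smul_dotProduct, smul_eq_mul]; ring)
    (fun u w₁ w₂ => by
      rw [← Complex.add_re]; congr 1; simp only [herm, lift_add, star_add, dotProduct_add]; ring)
    (fun c u w => by
      rw [smul_eq_mul, ← Complex.re_ofReal_mul]; congr 1
      simp only [herm, lift_smul, star_smul, dotProduct_smul, smul_eq_mul, Complex.star_def,
        Complex.conj_ofReal]; ring)

/-- `g` is a (pseudo-)Kähler metric on `U` compatible with the standard complex projective structure,
the class of the Levi-Civita connection of the Fubini–Study metric. -/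
def IsCompatibleMetric (g : BilinField) (U : Set CP2) : Prop :=
  IsPseudoKahler g U ∧ ComplexProjectivelyEquivalent (leviCivita g) (leviCivita fubiniStudy) U

/-- The real number `v* adj(C) v` for a hermitian matrix `C`. -/
def discr (C : Matrix (Fin 3) (Fin 3) ℂ) (v : C3) : ℝ := (star v ⬝ᵥ (C.adjugate *ᵥ v)).re

/-- The set of points `[v]` with `v* adj(C) v ≠ 0`, i.e. where the hermitian form `C` on covectors is
nondegenerate on the annihilator of `v`. -/
def regularSet (C : Matrix (Fin 3) (Fin 3) ℂ) : Set CP2 := {p | discr C (point p) ≠ 0}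

/-- The metric of the hermitian matrix `C`: at `[v]`, on the tangent vectors represented by `w` and
`w'`, it is the real part of
`- (v × w)ᵀ C conj(v × w') / (v* adj(C) v)²`.
For a frame `A = (v, a₁, a₂)` of determinant one and `H = A⁻¹ C (A⁻¹)*`, the hermitian matrix with
the entries `h₁₁ = -H₂₂`, `h₁₂ = H₂₁`, `h₂₁ = H₁₂`, `h₂₂ = -H₁₁` has determinant `v* adj(C) v`, and
this metric has the components `hᵢⱼ / (h₁₁ h₂₂ - |h₁₂|²)²` in the frame represented by `a₁, a₂`. -/
def metricOf (C : Matrix (Fin 3) (Fin 3) ℂ) : BilinField := fun p =>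
  LinearMap.mk₂ ℝ
    (fun u u' => (-((point p ⨯₃ lift u) ⬝ᵥ (C *ᵥ star (point p ⨯₃ lift u')))
      / (discr C (point p) : ℂ) ^ 2).re)
    (fun u₁ u₂ w => by
      rw [← Complex.add_re]; congr 1; simp only [lift_add, map_add, add_dotProduct]; ring)
    (fun c u w => by
      rw [smul_eq_mul, ← Complex.re_ofReal_mul]; congr 1
      simp only [lift_smul, map_smul, smul_dotProduct, smul_eq_mul]; ring)
    (fun u w₁ w₂ => by
      rw [← Complex.add_re]; congr 1
      simp only [lift_add, map_add, star_add, Matrix.mulVec_add, dotProduct_add]; ring)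
    (fun c u w => by
      rw [smul_eq_mul, ← Complex.re_ofReal_mul]; congr 1
      simp only [lift_smul, map_smul, star_smul, Matrix.mulVec_smul, dotProduct_smul, smul_eq_mul,
        Complex.star_def, Complex.conj_ofReal]; ring)

end CProj

end

/-!
The real lines of an affine chart are generalised geodesics of the Fubini–Study metric, so the
Levi-Civita connection `Γ` of a compatible metric `g` satisfies `Γ(u, u) ∈ ℂ u` there, that is
`Γ(u, w) = φ(u) w + φ(w) u` for a complex linear form `φ`. Then `g(u, u) ^ 3 / det ^ 2`, for the
determinant of `g` as a hermitian form, is constant along the line in the direction `u`. With the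
weight `r = det ^ (-1/3)` this says that the hermitian forms `Q_z = -r ^ 2 g_z` satisfy
`Q_z(y - z, y - z) = Q_y(y - z, y - z)`.

In homogeneous coordinates such a family is a symmetric kernel `m_Z(Y, Y) = m_Y(Z, Z)`, hermitian in
each variable, with `Z` in the kernel of `m_Z`. Symmetry extends it linearly from the forms
`B ↦ B(Z, Z)` to the whole dual space of the sesquilinear forms, and the result is alternating in
both pairs of variables: it is a hermitian form on `Λ²ℂ³ ≅ ℂ³`, so that
`m_Z(U, W) = (Z × U)ᵗ C conj(Z × W)`. The minors of `C` give `discr C = r`, hence `g = g_C` locally.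
Conversely `g_C` has the same determinant `discr C ^ (-3)`, so it determines `discr C`, then the
values of `C` on all covectors `Z × U` with `Z` near a point, and therefore `C`; connectedness makes
the local forms agree.
-/

noncomputable section

namespace CProj

open Filter Topology ComplexConjugate

section Polarization

variable {V M : Type*} [AddCommGroup V] [Module ℂ V] [AddCommGroup M] [Module ℂ M]

theorem eq_zero_of_apply_self_eq_zero {B : V →ₗ[ℂ] V →ₗ⋆[ℂ] M} (h : ∀ v, B v v = 0) : B = 0 := by
  ext v w
  have hskew : ∀ x, B v x + B x v = 0 := fun x => by
    simpa [h v, h x, add_comm] using h (v + x)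
  have hI := hskew (Complex.I • w)
  simp only [map_smulₛₗ, LinearMap.smul_apply, RingHom.id_apply, Complex.conj_I, neg_smul] at hI
  have h₂ : (2 * Complex.I) • B v w = 0 := by
    linear_combination (norm := module) Complex.I • hskew w - hI
  simpa using h₂

theorem apply_self_eq_zero_of_cubic_eq_zero {τ : V →ₗ[ℂ] V →ₗ[ℂ] V →ₗ⋆[ℂ] M}
    (h : ∀ v, τ v v v = 0) (v : V) : τ v v = 0 := by
  have hderiv : ∀ w, τ w v v + τ v w v + τ v v w = 0 := fun w => by
    have h₁ := h (v + w)
    have h₂ := h (v - w)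
    simp only [map_add, map_sub, LinearMap.add_apply, LinearMap.sub_apply, h v, h w] at h₁ h₂
    have h₃ : (2 : ℂ) • (τ w v v + τ v w v + τ v v w) = 0 := by
      linear_combination (norm := module) h₁ - h₂
    exact (smul_eq_zero_iff_right two_ne_zero).1 h₃
  ext w
  have hI := hderiv (Complex.I • w)
  simp only [map_smulₛₗ, LinearMap.smul_apply, RingHom.id_apply, Complex.conj_I, neg_smul] at hI
  have h₄ : (2 * Complex.I) • τ v v w = 0 := by
    linear_combination (norm := module) Complex.I • hderiv w - hI
  simpa using h₄

variable [TopologicalSpace V] [ContinuousAdd V] [ContinuousSMul ℂ V]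

theorem exists_ne_zero_forall_of_eventually {P : V → Prop} {v₀ : V} (h : ∀ᶠ v in 𝓝 v₀, P v)
    (w : V) (s : Finset ℝ) : ∃ c : ℝ, c ≠ 0 ∧ ∀ a ∈ s, P (v₀ + ((a * c : ℝ) : ℂ) • w) := by
  have hev : ∀ a ∈ s, ∀ᶠ c : ℝ in 𝓝 0, P (v₀ + ((a * c : ℝ) : ℂ) • w) := fun a _ => by
    have hc : Continuous fun c : ℝ => v₀ + ((a * c : ℝ) : ℂ) • w := by fun_prop
    exact hc.tendsto' 0 v₀ (by simp) |>.eventually h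
  have hne : ∀ᶠ c : ℝ in 𝓝[≠] 0, c ≠ 0 := self_mem_nhdsWithin
  exact (hne.and (nhdsWithin_le_nhds ((Finset.eventually_all s).2 hev))).exists

theorem eq_zero_of_eventually_apply_self_eq_zero {B : V →ₗ[ℂ] V →ₗ⋆[ℂ] M} {v₀ : V}
    (h : ∀ᶠ v in 𝓝 v₀, B v v = 0) : B = 0 := by
  refine eq_zero_of_apply_self_eq_zero fun w => ?_
  obtain ⟨c, hc, hw⟩ := exists_ne_zero_forall_of_eventually h w {-1, 0, 1}
  have hexp : ∀ t : ℝ, B (v₀ + (t : ℂ) • w) (v₀ + (t : ℂ) • w)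
      = B v₀ v₀ + (t : ℂ) • (B v₀ w + B w v₀) + (t ^ 2 : ℂ) • B w w := fun t => by
    simp only [map_add, LinearMap.add_apply, map_smulₛₗ, LinearMap.smul_apply, RingHom.id_apply,
      Complex.conj_ofReal]
    module
  simp only [hexp, Finset.forall_mem_insert, Finset.mem_singleton, forall_eq] at hw
  obtain ⟨h₁, h₀, h₂⟩ := hw
  push_cast at h₁ h₀ h₂
  have h₃ : (2 * c ^ 2 : ℂ) • B w w = 0 := by
    linear_combination (norm := module) h₁ + h₂ - (2 : ℂ) • h₀
  simpa [hc] using h₃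

theorem apply_self_eq_zero_of_eventually_cubic_eq_zero {τ : V →ₗ[ℂ] V →ₗ[ℂ] V →ₗ⋆[ℂ] M} {v₀ : V}
    (h : ∀ᶠ v in 𝓝 v₀, τ v v v = 0) (v : V) : τ v v = 0 := by
  refine apply_self_eq_zero_of_cubic_eq_zero (fun w => ?_) v
  obtain ⟨c, hc, hw⟩ := exists_ne_zero_forall_of_eventually h w {-1, 0, 1, 2}
  have hexp : ∀ t : ℝ, τ (v₀ + (t : ℂ) • w) (v₀ + (t : ℂ) • w) (v₀ + (t : ℂ) • w)
      = τ v₀ v₀ v₀ + (t : ℂ) • (τ w v₀ v₀ + τ v₀ w v₀ + τ v₀ v₀ w)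
        + (t ^ 2 : ℂ) • (τ v₀ w w + τ w v₀ w + τ w w v₀) + (t ^ 3 : ℂ) • τ w w w := fun t => by
    simp only [map_add, LinearMap.add_apply, map_smulₛₗ, LinearMap.smul_apply, RingHom.id_apply,
      Complex.conj_ofReal]
    module
  simp only [hexp, Finset.forall_mem_insert, Finset.mem_singleton, forall_eq] at hw
  obtain ⟨h₁, h₀, h₂, h₃⟩ := hw
  push_cast at h₁ h₀ h₂ h₃
  have h₄ : (6 * c ^ 3 : ℂ) • τ w w w = 0 := by
    linear_combination (norm := module) h₃ - (3 : ℂ) • h₂ + (3 : ℂ) • h₀ - h₁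
  simpa [hc] using h₄

end Polarization

section SymmetricKernel

variable {ι K H : Type*} [Field K] [AddCommGroup H] [Module K H]

theorem exists_linearMap_of_symmetric_kernel {e : ι → Module.Dual K H} {m : ι → H}
    (hsep : ∀ x, (∀ i, e i x = 0) → x = 0) (hsymm : ∀ i j, e i (m j) = e j (m i)) :
    ∃ T : Module.Dual K H →ₗ[K] H, ∀ i, T (e i) = m i := by
  let E := Finsupp.linearCombination K e
  let F := Finsupp.linearCombination K m
  have hFE : ∀ i a, e i (F a) = E a (m i) := fun i a => by
    simp [E, F, Finsupp.linearCombination_apply, Finsupp.sum, LinearMap.sum_apply, hsymm i]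
  have hker : LinearMap.ker E ≤ LinearMap.ker F := fun a ha => hsep _ fun i => by
    rw [hFE, LinearMap.mem_ker.1 ha, LinearMap.zero_apply]
  obtain ⟨T, hT⟩ := LinearMap.exists_extend
    ((LinearMap.ker E).liftQ F hker ∘ₗ E.quotKerEquivRange.symm.toLinearMap)
  refine ⟨T, fun i => ?_⟩
  have hi : E (Finsupp.single i 1) = e i := by simp [E]
  have hm : F (Finsupp.single i 1) = m i := by simp [F]
  have := LinearMap.congr_fun hT ⟨E (Finsupp.single i 1), LinearMap.mem_range_self _ _⟩
  rw [← hi, ← hm]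
  simpa [E.quotKerEquivRange_symm_apply_image] using this

end SymmetricKernel

section Extension

variable {V : Type*} [AddCommGroup V] [Module ℂ V]

/-- Evaluation at `(v, w)` of the sesquilinear forms on `V`. -/
def evalSesq : V →ₗ[ℂ] V →ₗ⋆[ℂ] Module.Dual ℂ (V →ₗ[ℂ] V →ₗ⋆[ℂ] ℂ) :=
  LinearMap.lflip.toLinearMap ∘ₗ LinearMap.id.flip

@[simp]
theorem evalSesq_apply (v w : V) (B : V →ₗ[ℂ] V →ₗ⋆[ℂ] ℂ) : evalSesq v w B = B v w := rfl

variable [TopologicalSpace V] [ContinuousAdd V] [ContinuousSMul ℂ V]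
  {ι : Type*} {s : ι → V} {v₀ : V}

theorem eq_zero_of_eventually_eq_smul {M : Type*} [AddCommGroup M] [Module ℂ M]
    {B : V →ₗ[ℂ] V →ₗ⋆[ℂ] M}
    (hs : ∀ᶠ v in 𝓝 v₀, ∃ i, ∃ c : ℂ, v = c • s i) (h : ∀ i, B (s i) (s i) = 0) : B = 0 := by
  refine eq_zero_of_eventually_apply_self_eq_zero (hs.mono ?_)
  rintro _ ⟨i, c, rfl⟩
  simp [h]

theorem exists_alternating_extension {m : ι → V →ₗ[ℂ] V →ₗ⋆[ℂ] ℂ}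
    (hs : ∀ᶠ v in 𝓝 v₀, ∃ i, ∃ c : ℂ, v = c • s i) (hker : ∀ i, m i (s i) = 0)
    (hsymm : ∀ i j, m i (s j) (s j) = m j (s i) (s i)) :
    ∃ Φ : V →ₗ[ℂ] V →ₗ⋆[ℂ] V →ₗ[ℂ] V →ₗ⋆[ℂ] ℂ, (∀ v v' w', Φ v v' v w' = 0) ∧
      (∀ v v' w, Φ v v' w v' = 0) ∧ ∀ i, Φ (s i) (s i) = m i := by
  obtain ⟨T, hT⟩ := exists_linearMap_of_symmetric_kernel (m := m)
    (e := fun i => evalSesq (s i) (s i)) (fun _ => eq_zero_of_eventually_eq_smul hs)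
    (fun i j => hsymm j i)
  let Φ := evalSesq.compr₂ₛₗ T
  have hΦ : ∀ i, Φ (s i) (s i) = m i := hT
  have halt : ∀ v v' w', Φ v v' v w' = 0 := fun v v' w' => by
    let τ : V →ₗ[ℂ] V →ₗ[ℂ] V →ₗ⋆[ℂ] V →ₗ⋆[ℂ] ℂ := LinearMap.lflip.toLinearMap ∘ₗ Φ
    have hτ : ∀ᶠ v in 𝓝 v₀, τ v v v = 0 := hs.mono <| by
      rintro _ ⟨i, c, rfl⟩
      simp [τ, hΦ, hker]
    exact LinearMap.congr_fun₂ (apply_self_eq_zero_of_eventually_cubic_eq_zero hτ v) v' w'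
  have hswap : ∀ v v' w w', Φ v v' w w' = Φ w w' v v' := fun v v' w w' => by
    have hswap_left : ∀ i, Φ.compr₂ₛₗ (evalSesq (s i) (s i)) = Φ (s i) (s i) := fun i =>
      sub_eq_zero.1 <| eq_zero_of_eventually_eq_smul hs fun j => by simp [hΦ, hsymm i j]
    have hswap_right : Φ.compr₂ₛₗ (evalSesq w w') = Φ w w' :=
      sub_eq_zero.1 <| eq_zero_of_eventually_eq_smul hs fun i => by
        simpa [sub_eq_zero] using (LinearMap.congr_fun₂ (hswap_left i) w w').symm
    exact LinearMap.congr_fun₂ hswap_right v v'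
  refine ⟨Φ, halt, fun v v' w => ?_, hΦ⟩
  have hneg : Φ v v' w v' + Φ w v' v v' = 0 := by
    simpa [halt] using halt (v + w) v' v'
  have htwo : (2 : ℂ) * Φ v v' w v' = 0 := by linear_combination hneg + hswap v v' w v'
  simpa using htwo

end Extension

section HermitianForm

variable {n : Type*} [Fintype n] [DecidableEq n]

/-- The sesquilinear form `ξᵗ C η̄` of a complex matrix `C`, as in the definition of `metricOf`. -/
def hform : Matrix n n ℂ ≃ₗ[ℂ] ((n → ℂ) →ₗ[ℂ] (n → ℂ) →ₗ⋆[ℂ] ℂ) :=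
  Matrix.toLinearMapₛₗ₂' ℂ (RingHom.id ℂ) (starRingEnd ℂ)

theorem hform_apply (C : Matrix n n ℂ) (ξ η : n → ℂ) : hform C ξ η = ξ ⬝ᵥ (C *ᵥ star η) := by
  simp only [hform, Matrix.toLinearMapₛₗ₂'_apply, dotProduct, Matrix.mulVec, Finset.mul_sum,
    Pi.star_apply, RingHom.id_apply, smul_eq_mul, starRingEnd_apply]
  exact Finset.sum_congr rfl fun i _ => Finset.sum_congr rfl fun j _ => by ring

theorem hform_single (C : Matrix n n ℂ) (i j : n) :
    hform C (Pi.single i 1) (Pi.single j 1) = C i j := by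
  simp [hform_apply]

theorem hform_conjTranspose (C : Matrix n n ℂ) (ξ η : n → ℂ) :
    hform Cᴴ ξ η = star (hform C η ξ) := by
  rw [hform_apply, hform_apply, ← star_star η, ← Matrix.star_dotProduct, Matrix.star_mulVec,
    star_star, star_star, Matrix.dotProduct_mulVec]

theorem star_hform {C : Matrix n n ℂ} (hC : C.IsHermitian) (ξ η : n → ℂ) :
    star (hform C ξ η) = hform C η ξ := by
  rw [← hform_conjTranspose, hC.eq]

end HermitianForm

section Cross

theorem cross_map_eq_sum {R M : Type*} [CommRing R] [AddCommGroup M] [Module R M] {σ : R →+* R}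
    {B : (Fin 3 → R) →ₛₗ[σ] (Fin 3 → R) →ₛₗ[σ] M} (hB : ∀ u, B u u = 0) (u w : Fin 3 → R) :
    B u w = ∑ i, σ ((u ⨯₃ w) i) • B (Pi.single (i + 1) 1) (Pi.single (i + 2) 1) := by
  have hskew : ∀ u w, B u w = -B w u := fun u w =>
    eq_neg_of_add_eq_zero_left (by simpa [hB, add_comm] using hB (u + w))
  have h₁ := hskew (Pi.single 1 1) (Pi.single 0 1)
  have h₂ := hskew (Pi.single 2 1) (Pi.single 1 1)
  have h₃ := hskew (Pi.single 0 1) (Pi.single 2 1)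
  conv_lhs => rw [pi_eq_sum_univ' u, pi_eq_sum_univ' w]
  simp only [Fin.sum_univ_three, map_add, map_smulₛₗ, LinearMap.add_apply, LinearMap.smul_apply,
    hB, h₁, h₂, h₃, cross_apply, Matrix.cons_val, map_sub, map_mul, zero_add, Fin.reduceAdd]
  module

theorem exists_cross_eq {K : Type*} [Field K] (ξ : Fin 3 → K) : ∃ v w : Fin 3 → K, v ⨯₃ w = ξ := by
  by_cases h : ξ 0 = 0
  · refine ⟨![1, 0, 0], ![0, ξ 2, -ξ 1], ?_⟩
    ext i
    fin_cases i <;> simp [cross_apply, h]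
  · refine ⟨![ξ 1, -ξ 0, 0], ![ξ 2 / ξ 0, 0, -1], ?_⟩
    ext i
    fin_cases i <;> simp [cross_apply, mul_div_cancel₀, h]

variable {ι : Type*} {s : ι → C3} {v₀ : C3}

theorem eq_zero_of_hform_cross_self {C : Matrix (Fin 3) (Fin 3) ℂ}
    (hs : ∀ᶠ v in 𝓝 v₀, ∃ i, ∃ c : ℂ, v = c • s i)
    (h : ∀ i u, hform C (s i ⨯₃ u) (s i ⨯₃ u) = 0) : C = 0 := by
  refine hform.map_eq_zero_iff.1 (eq_zero_of_apply_self_eq_zero fun ξ => ?_)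
  obtain ⟨v, w, rfl⟩ := exists_cross_eq ξ
  let B := ((hform C).comp (crossProduct.flip w)).compl₂ (crossProduct.flip w)
  have hB : B = 0 := eq_zero_of_eventually_eq_smul hs fun i => by simpa [B] using h i w
  simpa [B] using LinearMap.congr_fun₂ hB v v

theorem exists_hform_cross_eq {m : ι → C3 →ₗ[ℂ] C3 →ₗ⋆[ℂ] ℂ}
    (hs : ∀ᶠ v in 𝓝 v₀, ∃ i, ∃ c : ℂ, v = c • s i) (hker : ∀ i, m i (s i) = 0)
    (hsymm : ∀ i j, m i (s j) (s j) = m j (s i) (s i)) :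
    ∃ C : Matrix (Fin 3) (Fin 3) ℂ, ∀ i u w, m i u w = hform C (s i ⨯₃ u) (s i ⨯₃ w) := by
  obtain ⟨Φ, hleft, hright, hΦ⟩ := exists_alternating_extension hs hker hsymm
  let b : Fin 3 → C3 := fun i => Pi.single i 1
  refine ⟨Matrix.of fun i j => Φ (b (i + 1)) (b (j + 1)) (b (i + 2)) (b (j + 2)), fun i u w => ?_⟩
  have hl := LinearMap.congr_fun
    (cross_map_eq_sum (B := Φ.flip (s i)) (fun v => LinearMap.ext (hleft v _)) (s i) u) w
  have hr := fun a =>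
    cross_map_eq_sum (B := (Φ (b (a + 1))).flip (b (a + 2))) (fun v => hright _ v _) (s i) w
  simp only [LinearMap.flip_apply, LinearMap.sum_apply, LinearMap.smul_apply] at hl hr
  rw [← hΦ, hl, hform_apply]
  refine Finset.sum_congr rfl fun a _ => congrArg _ ?_
  rw [hr]
  exact Finset.sum_congr rfl fun _ _ => mul_comm _ _

theorem exists_isHermitian_hform_cross_eq {m : ι → C3 →ₗ[ℂ] C3 →ₗ⋆[ℂ] ℂ}
    (hs : ∀ᶠ v in 𝓝 v₀, ∃ i, ∃ c : ℂ, v = c • s i) (hker : ∀ i, m i (s i) = 0)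
    (hsymm : ∀ i j, m i (s j) (s j) = m j (s i) (s i))
    (hherm : ∀ i u, (starRingEnd ℂ) (m i u u) = m i u u) :
    ∃ C : Matrix (Fin 3) (Fin 3) ℂ, C.IsHermitian ∧
      ∀ i u w, m i u w = hform C (s i ⨯₃ u) (s i ⨯₃ w) := by
  obtain ⟨C, hC⟩ := exists_hform_cross_eq hs hker hsymm
  refine ⟨C, sub_eq_zero.1 <| eq_zero_of_hform_cross_self hs fun i u => ?_, hC⟩
  rw [map_sub, LinearMap.sub_apply, LinearMap.sub_apply, hform_conjTranspose, ← hC, sub_eq_zero]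
  exact hherm i u

end Cross

section Charts

variable (k l : Fin 3) (z u : C2)

theorem direction_self : direction k u k = 0 := by
  simp [direction]

theorem direction_succAbove (i : Fin 2) : direction k u (k.succAbove i) = u i := by
  simp [direction]

theorem direction_complex_smul (c : ℂ) : direction k (c • u) = c • direction k u := by
  ext j
  rcases Fin.eq_self_or_eq_succAbove k j with rfl | ⟨i, rfl⟩ <;> simp [direction]

theorem homog_add : homog k (z + u) = homog k z + direction k u := by
  ext j
  rcases Fin.eq_self_or_eq_succAbove k j with rfl | ⟨i, rfl⟩ <;> simp [homog, direction]

theorem contDiff_homog : ContDiff ℝ ∞ (homog k) := by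
  refine contDiff_pi.2 fun j => ?_
  rcases Fin.eq_self_or_eq_succAbove k j with rfl | ⟨i, rfl⟩
  · simpa only [homog_self] using contDiff_const
  · simpa only [homog_succAbove] using contDiff_apply ℝ ℂ i

theorem hasDerivAt_line (t : ℝ) : HasDerivAt (fun s : ℝ => z + s • u) u t := by
  simpa using ((hasDerivAt_id t).smul_const u).const_add z

theorem hasDerivAt_homog_line (t : ℝ) :
    HasDerivAt (fun s : ℝ => homog k (z + s • u)) (direction k u) t := by
  have h := ((Complex.ofRealCLM.hasDerivAt (x := t)).smul_const (direction k u)).const_add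
    (homog k z)
  simpa [homog_add, direction_smul] using h

theorem eventually_eq_smul_homog {N : Set C2} (hN : N ∈ 𝓝 z) :
    ∀ᶠ v in 𝓝 (homog k z), ∃ y : N, ∃ c : ℂ, v = c • homog k y := by
  have hdehom : ContinuousAt (fun v : C3 => fun i => v (k.succAbove i) / v k) (homog k z) :=
    continuousAt_pi.2 fun i => (continuousAt_apply _ _).div (continuousAt_apply _ _) (by
      simp [homog_self])
  have hz : (fun i => homog k z (k.succAbove i) / homog k z k) = z := by
    simp [homog_self, homog_succAbove]
  have hne : ∀ᶠ v in 𝓝 (homog k z), v k ≠ 0 :=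
    (continuousAt_apply k _).eventually_ne (by simp [homog_self])
  filter_upwards [hdehom (hz.symm ▸ hN), hne] with v hv hvk
  refine ⟨⟨_, hv⟩, v k, ?_⟩
  ext j
  rcases Fin.eq_self_or_eq_succAbove k j with rfl | ⟨i, rfl⟩
  · simp [homog_self]
  · simp [homog_succAbove, mul_div_cancel₀, hvk]

/-- `v_l²` times the differential at `v` of the projection `ℂ³ ∖ {0} → ℂP²`, read in the `l`-th
affine chart. -/
def chartProj (l : Fin 3) (v : C3) : C3 →ₗ[ℂ] C2 :=
  LinearMap.pi fun i => v l • LinearMap.proj (l.succAbove i) - v (l.succAbove i) • LinearMap.proj l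

theorem chartProj_apply (v w : C3) (i : Fin 2) :
    chartProj l v w i = v l * w (l.succAbove i) - v (l.succAbove i) * w l := rfl

theorem chartProj_self (v : C3) : chartProj l v v = 0 := by
  ext i
  simp [chartProj_apply, mul_comm]

theorem direction_chartProj (v w : C3) : direction l (chartProj l v w) = v l • w - w l • v := by
  ext j
  rcases Fin.eq_self_or_eq_succAbove l j with rfl | ⟨i, rfl⟩
  · simp [direction_self, mul_comm]
  · simp [direction_succAbove, chartProj_apply, mul_comm]

theorem chartProj_homog_direction : chartProj k (homog k z) (direction k u) = u := by
  ext i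
  simp [chartProj_apply, homog_self, direction_self, direction_succAbove]

theorem chartProj_homog_homog (y : C2) : chartProj k (homog k z) (homog k y) = y - z := by
  conv_lhs => rw [← add_sub_cancel z y, homog_add, map_add, chartProj_self, zero_add]
  exact chartProj_homog_direction k z (y - z)

theorem chartProj_homog_add_smul (t : ℝ) :
    chartProj l (homog k (z + t • u)) (direction k u)
      = chartProj l (homog k z) (direction k u) := by
  ext i
  simp only [chartProj_apply, homog_add, direction_smul, Pi.add_apply, Pi.smul_apply, smul_eq_mul]
  ring

variable {k l z u} in
theorem eq_zero_of_chartProj_direction_eq_zero (hl : homog k z l ≠ 0)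
    (h : chartProj l (homog k z) (direction k u) = 0) : u = 0 := by
  have hv : homog k z l • direction k u = direction k u l • homog k z := by
    have h0 : direction l 0 = 0 := by simpa using direction_smul l 0 0
    rw [← sub_eq_zero, ← direction_chartProj, h, h0]
  have hul : direction k u l = 0 := by
    simpa [direction_self, homog_self] using (congrFun hv k).symm
  ext i
  simpa [hul, direction_succAbove, hl] using congrFun hv (k.succAbove i)

theorem affineChart_mk (v : C3) (hv : v ≠ 0) (i : Fin 2) :
    affineChart l (Projectivization.mk ℂ v hv) i = v (l.succAbove i) / v l := by
  obtain ⟨a, ha, h⟩ := exists_rep_eq v hv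
  change (Projectivization.mk ℂ v hv).rep _ / (Projectivization.mk ℂ v hv).rep _ = _
  rw [h]
  exact mul_div_mul_left _ _ ha

theorem mk_mem_source_iff (v : C3) (hv : v ≠ 0) :
    Projectivization.mk ℂ v hv ∈ (affineChart l).source ↔ v l ≠ 0 := by
  obtain ⟨a, ha, h⟩ := exists_rep_eq v hv
  change (Projectivization.mk ℂ v hv).rep l ≠ 0 ↔ _
  simp [h, ha]

theorem homog_affineChart_mk (v : C3) (hv : v ≠ 0) (hl : v l ≠ 0) :
    homog l (affineChart l (Projectivization.mk ℂ v hv)) = (v l)⁻¹ • v := by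
  ext j
  rcases Fin.eq_self_or_eq_succAbove l j with rfl | ⟨i, rfl⟩
  · simp [homog_self, hl]
  · simp [homog_succAbove, affineChart_mk, div_eq_inv_mul]

theorem affineChart_symm_apply :
    (affineChart k).symm z = Projectivization.mk ℂ (homog k z) (homog_ne_zero k z) := rfl

theorem affineChart_affineChart_symm : affineChart k ((affineChart k).symm z) = z :=
  (affineChart k).right_inv (Set.mem_univ z)

variable {k} in
theorem affineChart_symm_affineChart {p : CP2} (hp : p ∈ (affineChart k).source) :
    (affineChart k).symm (affineChart k p) = p :=
  (affineChart k).left_inv hp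

theorem exists_eq_affineChart_symm (p : CP2) : ∃ k z, p = (affineChart k).symm z :=
  ⟨index p, _, (affineChart_symm_affineChart (rep_index_ne_zero p)).symm⟩

theorem continuous_affineChart_symm : Continuous (affineChart k).symm :=
  continuousOn_univ.1 (affineChart k).continuousOn_symm

theorem isOpen_coordDomain {U : Set CP2} (hU : IsOpen U) : IsOpen (coordDomain U k) :=
  hU.preimage (continuous_affineChart_symm k)

/-- The index of the preferred chart around `[homog k z]`. -/
def symmIndex (k : Fin 3) (z : C2) : Fin 3 := index ((affineChart k).symm z)

theorem homog_symmIndex_ne_zero : homog k z (symmIndex k z) ≠ 0 :=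
  (mk_mem_source_iff _ _ (homog_ne_zero k z)).1 (rep_index_ne_zero ((affineChart k).symm z))

theorem point_affineChart_symm :
    point ((affineChart k).symm z) = (homog k z (symmIndex k z))⁻¹ • homog k z :=
  homog_affineChart_mk _ _ _ (homog_symmIndex_ne_zero k z)

/-- The real line through `z` in the direction `u` of the `k`-th affine chart. -/
def chartLine (t : ℝ) : CP2 := (affineChart k).symm (z + t • u)

theorem affineChart_chartLine :
    affineChart l ∘ chartLine k z u = fun t : ℝ => fun i =>
      homog k (z + t • u) (l.succAbove i) / homog k (z + t • u) l := by
  ext t i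
  rw [Function.comp, chartLine, affineChart_symm_apply, affineChart_mk]

theorem chartLine_mem_source_iff (t : ℝ) :
    chartLine k z u t ∈ (affineChart l).source ↔ homog k (z + t • u) l ≠ 0 := by
  rw [chartLine, affineChart_symm_apply, mk_mem_source_iff]

variable {l} in
theorem hasDerivAt_affineChart_chartLine {t : ℝ} (h : homog k (z + t • u) l ≠ 0) :
    HasDerivAt (affineChart l ∘ chartLine k z u)
      ((homog k (z + t • u) l ^ 2)⁻¹ • chartProj l (homog k z) (direction k u)) t := by
  have hv := fun j => hasDerivAt_pi.1 (hasDerivAt_homog_line k z u t) j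
  rw [affineChart_chartLine]
  refine hasDerivAt_pi.2 fun i => ((hv _).div (hv l) h).congr_deriv ?_
  rw [← chartProj_homog_add_smul k l z u t, Pi.smul_apply, chartProj_apply, smul_eq_mul,
    div_eq_inv_mul, mul_comm (direction k u _)]

/-- The differential of the parametrisation `z ↦ [homog k z]`. -/
def dsymm (k : Fin 3) (z : C2) : C2 →L[ℝ] C2 :=
  mfderiv 𝓘(ℝ, C2) 𝓘(ℝ, C2) (affineChart k).symm z

theorem inChart_eq (g : BilinField) (w : C2) :
    g.inChart k z u w = g ((affineChart k).symm z) (dsymm k z u) (dsymm k z w) := rfl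

theorem hasFDerivAt_affineChart_symm :
    HasFDerivAt (affineChart (symmIndex k z) ∘ (affineChart k).symm) (dsymm k z) z := by
  have : IsManifold 𝓘(ℝ, C2) 1 CP2 := IsManifold.of_le (n := ∞) (by norm_cast)
  have hm : MDifferentiableAt 𝓘(ℝ, C2) 𝓘(ℝ, C2) (affineChart k).symm z :=
    mdifferentiableAt_atlas_symm (H := C2) (Set.mem_range_self k) (Set.mem_univ z)
  have h : HasFDerivWithinAt (affineChart (symmIndex k z) ∘ (affineChart k).symm) (dsymm k z)
      (Set.range 𝓘(ℝ, C2)) z := hm.hasMFDerivAt.2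
  rwa [modelWithCornersSelf_coe, Set.range_id, hasFDerivWithinAt_univ] at h

theorem dsymm_apply :
    dsymm k z u = (homog k z (symmIndex k z) ^ 2)⁻¹
      • chartProj (symmIndex k z) (homog k z) (direction k u) := by
  have h : HasDerivAt (affineChart (symmIndex k z) ∘ chartLine k z u) (dsymm k z u) 0 :=
    HasFDerivAt.comp_hasDerivAt (0 : ℝ)
      (by rw [zero_smul, add_zero]; exact hasFDerivAt_affineChart_symm k z) (hasDerivAt_line z u 0)
  simpa using h.unique (hasDerivAt_affineChart_chartLine k z u
    (by simpa using homog_symmIndex_ne_zero k z))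

theorem dsymm_I : dsymm k z (Complex.I • u) = Complex.I • dsymm k z u := by
  rw [dsymm_apply, dsymm_apply, direction_complex_smul, map_smul, smul_comm]

theorem dsymm_injective : Function.Injective (dsymm k z) := by
  refine (injective_iff_map_eq_zero (dsymm k z)).2 fun u hu => ?_
  have hne := homog_symmIndex_ne_zero k z
  rw [dsymm_apply, smul_eq_zero_iff_right (inv_ne_zero (pow_ne_zero 2 hne))] at hu
  exact eq_zero_of_chartProj_direction_eq_zero hne hu

theorem dsymm_surjective : Function.Surjective (dsymm k z) := by
  have h : Function.Injective (dsymm k z : C2 →ₗ[ℝ] C2) := dsymm_injective k z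
  exact LinearMap.injective_iff_surjective.1 h

theorem point_cross_direction_dsymm :
    point ((affineChart k).symm z) ⨯₃ direction (symmIndex k z) (dsymm k z u)
      = (homog k z (symmIndex k z))⁻¹ ^ 2 • (homog k z ⨯₃ direction k u) := by
  have hne := homog_symmIndex_ne_zero k z
  rw [dsymm_apply, direction_complex_smul, direction_chartProj, point_affineChart_symm]
  simp only [map_smul, map_sub, LinearMap.smul_apply, cross_self, smul_zero, sub_zero, smul_smul]
  congr 1
  field_simp

variable {k z} in
theorem eq_of_inChart_eq {g g' : BilinField} (h : ∀ u w, g.inChart k z u w = g'.inChart k z u w) :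
    g ((affineChart k).symm z) = g' ((affineChart k).symm z) := by
  refine LinearMap.ext fun a => LinearMap.ext fun b => ?_
  obtain ⟨u, rfl⟩ := dsymm_surjective k z a
  obtain ⟨w, rfl⟩ := dsymm_surjective k z b
  exact h u w

end Charts

section HermitianFormCalculus

variable {n : Type*} [Fintype n] [DecidableEq n]

theorem hform_symm_apply (B : (n → ℂ) →ₗ[ℂ] (n → ℂ) →ₗ⋆[ℂ] ℂ) (i j : n) :
    hform.symm B i j = B (Pi.single i 1) (Pi.single j 1) :=
  (hform_single _ i j).symm.trans (by rw [LinearEquiv.apply_symm_apply])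

theorem det_hform_symm_ne_zero_iff {B : (n → ℂ) →ₗ[ℂ] (n → ℂ) →ₗ⋆[ℂ] ℂ} :
    (hform.symm B).det ≠ 0 ↔ B.SeparatingLeft := by
  obtain ⟨M, rfl⟩ := hform.surjective B
  rw [LinearEquiv.symm_apply_apply, ← Matrix.separatingLeft_iff_det_ne_zero,
    Matrix.separatingLeft_def]
  refine forall_congr' fun u => imp_congr_left ?_
  simp only [hform_apply]
  exact star_involutive.surjective.forall

theorem contDiff_hform {E : Type*} [NormedAddCommGroup E] [NormedSpace ℝ E] {a b : E → n → ℂ}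
    (C : Matrix n n ℂ) (ha : ContDiff ℝ ∞ a) (hb : ContDiff ℝ ∞ b) :
    ContDiff ℝ ∞ fun x => hform C (a x) (b x) := by
  have hb' : ∀ j, ContDiff ℝ ∞ fun x => star (b x j) := fun j =>
    Complex.conjCLE.contDiff.comp (contDiff_pi.1 hb j)
  simp only [hform_apply, dotProduct, Matrix.mulVec, Pi.star_apply]
  fun_prop

theorem hasDerivAt_hform {a b : ℝ → n → ℂ} {a' b' : n → ℂ} {t : ℝ} (C : Matrix n n ℂ)
    (ha : HasDerivAt a a' t) (hb : HasDerivAt b b' t) :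
    HasDerivAt (fun s => hform C (a s) (b s)) (hform C a' (b t) + hform C (a t) b') t := by
  have hb' := fun j => (hasDerivAt_pi.1 hb j).star
  simp only [hform_apply, dotProduct, Matrix.mulVec, Pi.star_apply, ← Finset.sum_add_distrib]
  exact HasDerivAt.fun_sum fun i _ => (hasDerivAt_pi.1 ha i).mul
    (HasDerivAt.fun_sum fun j _ => (hb' j).const_mul (C i j))

end HermitianFormCalculus

section MetricOf

variable (C : Matrix (Fin 3) (Fin 3) ℂ)

/-- The sesquilinear form `(w, v) ↦ v* adj(C) w` on `ℂ³`, whose restriction to the diagonal is the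
complex-valued version of `discr C`. -/
def adjForm : C3 →ₗ[ℂ] C3 →ₗ⋆[ℂ] ℂ := hform C.adjugateᵀ

theorem adjForm_apply (v w : C3) : adjForm C w v = star v ⬝ᵥ (C.adjugate *ᵥ w) := by
  rw [adjForm, hform_apply, Matrix.mulVec_transpose, dotProduct_comm, Matrix.dotProduct_mulVec]

variable {C} in
theorem star_adjForm (hC : C.IsHermitian) (v w : C3) : star (adjForm C w v) = adjForm C v w :=
  star_hform hC.adjugate.transpose w v

variable {C} in
theorem ofReal_discr (hC : C.IsHermitian) (v : C3) : (discr C v : ℂ) = adjForm C v v := by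
  rw [discr, ← adjForm_apply]
  exact Complex.conj_eq_iff_re.1 (star_adjForm hC v v)

theorem discr_smul (a : ℂ) (v : C3) : discr C (a • v) = Complex.normSq a * discr C v := by
  rw [discr, discr, ← Complex.re_ofReal_mul, Complex.normSq_eq_conj_mul_self]
  simp [Matrix.mulVec_smul, mul_assoc, mul_left_comm]

theorem symm_mem_regularSet_iff (k : Fin 3) (z : C2) :
    (affineChart k).symm z ∈ regularSet C ↔ discr C (homog k z) ≠ 0 := by
  rw [regularSet, Set.mem_ofPred_eq, point_affineChart_symm, discr_smul]
  simp [homog_symmIndex_ne_zero k z]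

theorem star_cross (u w : C3) : star (u ⨯₃ w) = star u ⨯₃ star w := by
  ext j
  fin_cases j <;> simp [cross_apply]

theorem hform_det (ξ₁ ξ₂ η₁ η₂ : C3) :
    hform C ξ₁ η₁ * hform C ξ₂ η₂ - hform C ξ₁ η₂ * hform C ξ₂ η₁
      = adjForm C (ξ₁ ⨯₃ ξ₂) (η₁ ⨯₃ η₂) := by
  rw [adjForm_apply, star_cross]
  simp only [hform_apply, Matrix.adjugate_fin_three, cross_apply, dotProduct, Matrix.mulVec,
    Fin.sum_univ_three, Pi.star_apply, Matrix.of_apply, Matrix.cons_val]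
  ring

/-- The covector `v × w` of the complex line through `[v]` in the direction of `u` in the `k`-th
affine chart. -/
def crossVec (k : Fin 3) (z : C2) : C2 →ₗ[ℂ] C3 where
  toFun u := homog k z ⨯₃ direction k u
  map_add' u w := by rw [direction_add, map_add]
  map_smul' c u := by rw [direction_complex_smul, map_smul, RingHom.id_apply]

theorem crossVec_apply (k : Fin 3) (z u : C2) :
    crossVec k z u = homog k z ⨯₃ direction k u := rfl

theorem contDiff_crossVec (k : Fin 3) (u : C2) : ContDiff ℝ ∞ fun z => crossVec k z u := by
  have h := contDiff_pi.1 (contDiff_homog k)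
  refine contDiff_pi.2 fun j => ?_
  fin_cases j <;> simp only [crossVec_apply, cross_apply] <;>
    exact ((h _).mul contDiff_const).sub ((h _).mul contDiff_const)

theorem hasDerivAt_crossVec_line (k : Fin 3) (z u w : C2) :
    HasDerivAt (fun t : ℝ => crossVec k (z + t • u) w) (direction k u ⨯₃ direction k w) 0 := by
  have h := ((Complex.ofRealCLM.hasDerivAt (x := 0)).smul_const
    (direction k u ⨯₃ direction k w)).const_add (crossVec k z w)
  simpa [crossVec_apply, homog_add, direction_smul] using h

theorem crossVec_single_cross (k : Fin 3) (z : C2) :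
    crossVec k z (Pi.single 0 1) ⨯₃ crossVec k z (Pi.single 1 1)
      = ((-1) ^ (k : ℕ) : ℂ) • homog k z := by
  have h₀ : (Pi.single 0 1 : C2) = ![1, 0] := by ext i; fin_cases i <;> rfl
  have h₁ : (Pi.single 1 1 : C2) = ![0, 1] := by ext i; fin_cases i <;> rfl
  rw [h₀, h₁]
  ext j
  fin_cases k <;> fin_cases j <;>
    simp [crossVec_apply, cross_apply, homog, direction, Fin.insertNth, Fin.succAboveCases]

/-- The sesquilinear form `(v × w)ᵗ C conj(v × w')` on the tangent space, in the `k`-th affine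
chart. -/
def crossForm (k : Fin 3) (z : C2) : C2 →ₗ[ℂ] C2 →ₗ⋆[ℂ] ℂ :=
  ((hform C).comp (crossVec k z)).compl₂ (crossVec k z)

theorem crossForm_apply (k : Fin 3) (z u w : C2) :
    crossForm C k z u w = hform C (crossVec k z u) (crossVec k z w) := rfl

variable {C} in
theorem det_hform_symm_crossForm (hC : C.IsHermitian) (k : Fin 3) (z : C2) :
    (hform.symm (crossForm C k z)).det = discr C (homog k z) := by
  simp only [Matrix.det_fin_two, hform_symm_apply, crossForm_apply]
  rw [hform_det, crossVec_single_cross, ofReal_discr hC, map_smulₛₗ, map_smulₛₗ]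
  simp only [LinearMap.smul_apply, smul_smul, map_pow, map_neg, map_one]
  rw [← mul_pow]
  simp

/-- The hermitian form whose real part is the expression of `metricOf C` in the `k`-th affine
chart. -/
def metricHerm (k : Fin 3) (z : C2) : C2 →ₗ[ℂ] C2 →ₗ⋆[ℂ] ℂ :=
  (-((discr C (homog k z) : ℂ) ^ 2)⁻¹) • crossForm C k z

theorem metricHerm_apply (k : Fin 3) (z u w : C2) :
    metricHerm C k z u w = -crossForm C k z u w / (discr C (homog k z) : ℂ) ^ 2 := by
  simp only [metricHerm, LinearMap.smul_apply, smul_eq_mul]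
  ring

variable {C} in
theorem star_metricHerm (hC : C.IsHermitian) (k : Fin 3) (z u w : C2) :
    star (metricHerm C k z u w) = metricHerm C k z w u := by
  simp [metricHerm_apply, crossForm_apply, ← star_hform hC (crossVec k z u)]

theorem inChart_metricOf (k : Fin 3) (z u w : C2) :
    (metricOf C).inChart k z u w = (metricHerm C k z u w).re := by
  change (-((point ((affineChart k).symm z) ⨯₃ direction (symmIndex k z) (dsymm k z u)) ⬝ᵥ
    (C *ᵥ star (point ((affineChart k).symm z) ⨯₃ direction (symmIndex k z) (dsymm k z w))))
      / (discr C (point ((affineChart k).symm z)) : ℂ) ^ 2).re = _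
  have hne := homog_symmIndex_ne_zero k z
  rw [← hform_apply, point_cross_direction_dsymm, point_cross_direction_dsymm,
    point_affineChart_symm, discr_smul, metricHerm_apply, crossForm_apply]
  set a := (homog k z (symmIndex k z))⁻¹
  have ha : a ≠ 0 := inv_ne_zero hne
  have hs : (starRingEnd ℂ) a ≠ 0 := (map_ne_zero _).2 ha
  congr 1
  rw [map_smulₛₗ, map_smulₛₗ, Complex.ofReal_mul, Complex.normSq_eq_conj_mul_self, map_pow,
    ← crossVec_apply, ← crossVec_apply]
  simp only [LinearMap.smul_apply, smul_eq_mul, RingHom.id_apply]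
  rw [← mul_div_mul_left _ ((discr C (homog k z) : ℂ) ^ 2)
    (pow_ne_zero 2 (mul_ne_zero hs ha))]
  congr 1 <;> ring

theorem contDiffAt_inChart_metricOf {k : Fin 3} {z : C2} (hz : discr C (homog k z) ≠ 0)
    (u w : C2) : ContDiffAt ℝ ∞ (fun x => (metricOf C).inChart k x u w) z := by
  have hdiscr : ContDiff ℝ ∞ fun x => discr C (homog k x) := by
    simp only [discr, ← adjForm_apply]
    exact Complex.reCLM.contDiff.comp
      (contDiff_hform _ (contDiff_homog k) (contDiff_homog k))
  have hnum := contDiff_hform C (contDiff_crossVec k u) (contDiff_crossVec k w)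
  have hden := (Complex.ofRealCLM.contDiff.comp hdiscr).pow 2
  simp only [inChart_metricOf, metricHerm_apply, div_eq_mul_inv]
  exact Complex.reCLM.contDiff.contDiffAt.comp z <| hnum.neg.contDiffAt.mul <|
    hden.contDiffAt.inv <| pow_ne_zero 2 <| Complex.ofReal_ne_zero.2 hz

end MetricOf

section ChartForm

variable (g : BilinField) (k : Fin 3) (z : C2)

/-- The bundled version of `g.inChart k z`. -/
def chartForm : LinearMap.BilinForm ℝ C2 :=
  (g ((affineChart k).symm z)).compl₁₂ (dsymm k z : C2 →ₗ[ℝ] C2) (dsymm k z : C2 →ₗ[ℝ] C2)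

theorem chartForm_apply (u w : C2) : chartForm g k z u w = g.inChart k z u w := rfl

/-- The Koszul formula for the value `a = Γ(u, w)` of the Levi-Civita connection. -/
def IsKoszul (u w a : C2) : Prop :=
  ∀ y : C2, g.inChart k z a y =
    (fderiv ℝ (fun x => g.inChart k x w y) z u + fderiv ℝ (fun x => g.inChart k x u y) z w
      - fderiv ℝ (fun x => g.inChart k x u w) z y) / 2

variable {g k z}

theorem IsKoszul.of_fderiv_eq {Γ : C2 → C2 → C2}
    (hg : ∀ u w, g.inChart k z u w = g.inChart k z w u) (hΓ : ∀ u w, Γ u w = Γ w u)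
    (hmetric : ∀ u w y, fderiv ℝ (fun x => g.inChart k x w y) z u
      = g.inChart k z (Γ u w) y + g.inChart k z w (Γ u y)) (u w : C2) :
    IsKoszul g k z u w (Γ u w) := fun y => by
  rw [hmetric, hmetric, hmetric, hΓ w u, hΓ y u, hΓ y w, hg (Γ u y) w]
  ring

theorem inChart_I_I {U : Set CP2} (h : ∀ p ∈ U, ∀ u w : Tan p, g p (J u) (J w) = g p u w)
    (hz : z ∈ coordDomain U k) (u w : C2) :
    g.inChart k z (Complex.I • u) (Complex.I • w) = g.inChart k z u w := by
  rw [inChart_eq, dsymm_I, dsymm_I]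
  exact h _ hz _ _

theorem inChart_nondegenerate {U : Set CP2}
    (h : ∀ p ∈ U, ∀ u : Tan p, (∀ w : Tan p, g p u w = 0) → u = 0)
    (hz : z ∈ coordDomain U k) (u : C2) (hu : ∀ w, g.inChart k z u w = 0) : u = 0 := by
  apply dsymm_injective k z
  rw [map_zero]
  refine h _ hz _ fun w => ?_
  obtain ⟨w', rfl⟩ := dsymm_surjective k z w
  exact hu w'

theorem leviCivita_eq (hnd : ∀ u, (∀ w, g.inChart k z u w = 0) → u = 0) {u w a : C2}
    (ha : IsKoszul g k z u w a) : leviCivita g k z u w = a := by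
  have h : IsKoszul g k z u w (leviCivita g k z u w) := Classical.epsilon_spec ⟨a, ha⟩
  refine sub_eq_zero.1 (hnd _ fun y => ?_)
  rw [← chartForm_apply, map_sub, LinearMap.sub_apply, chartForm_apply, chartForm_apply, h y, ha y,
    sub_self]

end ChartForm

section Christoffel

theorem smul_cross_cyclic {R : Type*} [CommRing R] (a v u y : Fin 3 → R) :
    (a ⬝ᵥ v) • (u ⨯₃ y) + (a ⬝ᵥ u) • (y ⨯₃ v) + (a ⬝ᵥ y) • (v ⨯₃ u) = (v ⬝ᵥ u ⨯₃ y) • a := by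
  ext j
  fin_cases j <;> simp [cross_apply, dotProduct, Fin.sum_univ_three] <;> ring

theorem adjForm_mul_hform_cross (C : Matrix (Fin 3) (Fin 3) ℂ) (v w u y : C3) :
    adjForm C v v * hform C (v ⨯₃ w) (u ⨯₃ y)
      = adjForm C v u * hform C (v ⨯₃ w) (v ⨯₃ y)
        - adjForm C v y * hform C (v ⨯₃ w) (v ⨯₃ u) := by
  set a := star (C.adjugate *ᵥ v) with ha
  have hadj : ∀ x, (starRingEnd ℂ) (a ⬝ᵥ x) = adjForm C v x := fun x => by
    rw [adjForm_apply, starRingEnd_apply, ha, Matrix.star_dotProduct, star_star]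
  have hker : hform C (v ⨯₃ w) a = 0 := by
    rw [hform_apply, ha, star_star, Matrix.mulVec_mulVec, Matrix.mul_adjugate, Matrix.smul_mulVec,
      Matrix.one_mulVec, dotProduct_smul, dotProduct_comm, dot_self_cross, smul_zero]
  have h := congrArg (hform C (v ⨯₃ w)) (smul_cross_cyclic a v u y)
  simp only [map_add, map_smulₛₗ, hadj, hker, ← cross_anticomm v y, map_neg, smul_eq_mul] at h
  linear_combination h

variable (C : Matrix (Fin 3) (Fin 3) ℂ)

/-- The Levi-Civita connection of `metricOf C`. -/
def christoffelOf (k : Fin 3) (z u w : C2) : C2 :=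
  -((adjForm C (direction k u) (homog k z) / discr C (homog k z)) • w
    + (adjForm C (direction k w) (homog k z) / discr C (homog k z)) • u)

theorem christoffelOf_comm (k : Fin 3) (z u w : C2) :
    christoffelOf C k z u w = christoffelOf C k z w u := by
  rw [christoffelOf, christoffelOf, add_comm]

theorem christoffelOf_I (k : Fin 3) (z u w : C2) :
    christoffelOf C k z u (Complex.I • w) = Complex.I • christoffelOf C k z u w := by
  simp only [christoffelOf, direction_complex_smul, map_smul, LinearMap.smul_apply, smul_eq_mul]
  module

variable {C}

theorem hasDerivAt_crossForm_line (hC : C.IsHermitian) {k : Fin 3} {z : C2}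
    (hz : discr C (homog k z) ≠ 0) (u w y : C2) :
    HasDerivAt (fun t : ℝ => crossForm C k (z + t • u) w y)
      (((adjForm C (direction k u) (homog k z) + adjForm C (homog k z) (direction k u))
          * crossForm C k z w y
        - adjForm C (direction k w) (homog k z) * crossForm C k z u y
        - adjForm C (homog k z) (direction k y) * crossForm C k z w u)
        / discr C (homog k z)) 0 := by
  have hright := adjForm_mul_hform_cross C (homog k z) (direction k w) (direction k u)
    (direction k y)
  have hleft := congrArg star (adjForm_mul_hform_cross C (homog k z) (direction k y)
    (direction k u) (direction k w))
  simp only [star_sub, star_mul', star_hform hC, star_adjForm hC] at hleft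
  refine (hasDerivAt_hform C (hasDerivAt_crossVec_line k z u w)
    (hasDerivAt_crossVec_line k z u y)).congr_deriv ?_
  rw [zero_smul, add_zero, eq_div_iff (Complex.ofReal_ne_zero.2 hz), ofReal_discr hC]
  simp only [crossForm_apply, crossVec_apply]
  linear_combination hleft + hright

theorem hasDerivAt_discr_homog_line (hC : C.IsHermitian) (k : Fin 3) (z u : C2) :
    HasDerivAt (fun t : ℝ => (discr C (homog k (z + t • u)) : ℂ))
      (adjForm C (direction k u) (homog k z) + adjForm C (homog k z) (direction k u)) 0 := by
  have h := hasDerivAt_homog_line k z u 0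
  simp only [ofReal_discr hC]
  simpa [adjForm] using hasDerivAt_hform C.adjugateᵀ h h

theorem hasDerivAt_metricHerm_line (hC : C.IsHermitian) {k : Fin 3} {z : C2}
    (hz : discr C (homog k z) ≠ 0) (u w y : C2) :
    HasDerivAt (fun t : ℝ => metricHerm C k (z + t • u) w y)
      (metricHerm C k z (christoffelOf C k z u w) y
        + metricHerm C k z w (christoffelOf C k z u y)) 0 := by
  have hD : (discr C (homog k z) : ℂ) ≠ 0 := Complex.ofReal_ne_zero.2 hz
  have h := (hasDerivAt_crossForm_line hC hz u w y).neg.div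
    ((hasDerivAt_discr_homog_line hC k z u).pow 2) (by simpa using hz)
  simp only [metricHerm_apply]
  refine h.congr_deriv ?_
  have hconj : ∀ x : C2, (starRingEnd ℂ) (adjForm C (direction k x) (homog k z))
      = adjForm C (homog k z) (direction k x) := fun x => star_adjForm hC _ _
  simp only [christoffelOf, map_neg, map_add, map_smulₛₗ, map_div₀, hconj, Complex.conj_ofReal,
    LinearMap.neg_apply, LinearMap.add_apply, LinearMap.smul_apply, smul_eq_mul, RingHom.id_apply,
    Pi.neg_apply, Pi.pow_apply, zero_smul, add_zero]
  field_simp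
  ring

theorem fderiv_inChart_metricOf (hC : C.IsHermitian) {k : Fin 3} {z : C2}
    (hz : discr C (homog k z) ≠ 0) (u w y : C2) :
    fderiv ℝ (fun x => (metricOf C).inChart k x w y) z u
      = (metricOf C).inChart k z (christoffelOf C k z u w) y
        + (metricOf C).inChart k z w (christoffelOf C k z u y) := by
  have hdiff := (contDiffAt_inChart_metricOf C hz w y).differentiableAt (by simp)
  rw [← hdiff.lineDeriv_eq_fderiv, inChart_metricOf, inChart_metricOf, ← Complex.add_re]
  refine HasLineDerivAt.lineDeriv ?_
  simp only [HasLineDerivAt, inChart_metricOf]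
  exact Complex.reCLM.hasFDerivAt.comp_hasDerivAt (0 : ℝ) (hasDerivAt_metricHerm_line hC hz u w y)

theorem inChart_metricOf_comm (hC : C.IsHermitian) (k : Fin 3) (z u w : C2) :
    (metricOf C).inChart k z u w = (metricOf C).inChart k z w u := by
  rw [inChart_metricOf, inChart_metricOf, ← star_metricHerm hC, Complex.star_def, Complex.conj_re]

theorem inChart_metricOf_I_I (k : Fin 3) (z u w : C2) :
    (metricOf C).inChart k z (Complex.I • u) (Complex.I • w) = (metricOf C).inChart k z u w := by
  simp only [inChart_metricOf, map_smulₛₗ, LinearMap.smul_apply, smul_smul, Complex.conj_I,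
    RingHom.id_apply, neg_mul, Complex.I_mul_I, neg_neg, one_smul]

theorem metricOf_nondegenerate (hC : C.IsHermitian) {k : Fin 3} {z : C2}
    (hz : discr C (homog k z) ≠ 0) (u : C2) (hu : ∀ w, (metricOf C).inChart k z u w = 0) :
    u = 0 := by
  have hD : (discr C (homog k z) : ℂ) ≠ 0 := Complex.ofReal_ne_zero.2 hz
  refine det_hform_symm_ne_zero_iff.1 (by rwa [det_hform_symm_crossForm hC]) u fun w => ?_
  have hzero : metricHerm C k z u w = 0 := by
    refine Complex.ext (by rw [← inChart_metricOf, hu, Complex.zero_re]) ?_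
    have hIw := hu (Complex.I • w)
    rw [inChart_metricOf, map_smulₛₗ] at hIw
    simpa using hIw
  simpa [metricHerm_apply, hD] using hzero

theorem leviCivita_metricOf (hC : C.IsHermitian) {k : Fin 3} {z : C2}
    (hz : discr C (homog k z) ≠ 0) (u w : C2) :
    leviCivita (metricOf C) k z u w = christoffelOf C k z u w :=
  leviCivita_eq (metricOf_nondegenerate hC hz) <| IsKoszul.of_fderiv_eq
    (inChart_metricOf_comm hC k z) (christoffelOf_comm C k z) (fderiv_inChart_metricOf hC hz) u w

theorem isPseudoKahler_metricOf (hC : C.IsHermitian) {U : Set CP2} (hU : U ⊆ regularSet C) :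
    IsPseudoKahler (metricOf C) U := by
  have hreg : ∀ {k z}, z ∈ coordDomain U k → discr C (homog k z) ≠ 0 :=
    fun hz => (symm_mem_regularSet_iff _ _ _).1 (hU hz)
  refine ⟨fun k u w z hz => ?smooth, fun p hp a b => ?symm, fun p hp a ha => ?nondegenerate,
    fun p hp a b => ?hermitian, fun k z hz u w => ?parallel⟩
  case smooth => exact (contDiffAt_inChart_metricOf C (hreg hz) u w).contDiffWithinAt
  case parallel =>
    rw [leviCivita_metricOf hC (hreg hz), leviCivita_metricOf hC (hreg hz), christoffelOf_I]
  all_goals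
    obtain ⟨k, z, rfl⟩ := exists_eq_affineChart_symm p
    obtain ⟨u, rfl⟩ := dsymm_surjective k z a
  case nondegenerate =>
    rw [metricOf_nondegenerate hC (hreg hp) u fun w => ha (dsymm k z w), map_zero]
    rfl
  all_goals obtain ⟨w, rfl⟩ := dsymm_surjective k z b
  case symm => exact inChart_metricOf_comm hC k z u w
  case hermitian =>
    have h := inChart_metricOf_I_I (C := C) k z u w
    rwa [inChart_eq, dsymm_I, dsymm_I] at h

end Christoffel

section Planar

/-- In every affine chart `Γ(u, u)` is a complex multiple of `u`, so that the affine lines over `U`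
are generalised geodesics of `Γ`. -/
def IsPlanar (Γ : Christoffel) (U : Set CP2) : Prop :=
  ∀ k, ∀ z ∈ coordDomain U k, ∀ u, u ≠ 0 → ∃ c : ℂ, Γ k z u u = c • u

theorem IsPlanar.isGeneralisedGeodesic {Γ Γ' : Christoffel} {U : Set CP2} (h : IsPlanar Γ U)
    (h' : IsPlanar Γ' U) {I : Set ℝ} {γ : ℝ → CP2} (hγ : Set.MapsTo γ I U)
    (H : IsGeneralisedGeodesic Γ I γ) : IsGeneralisedGeodesic Γ' I γ := by
  refine ⟨H.smooth, H.immersed, fun t ht k hk => ?_⟩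
  have hz : affineChart k (γ t) ∈ coordDomain U k := by
    change (affineChart k).symm (affineChart k (γ t)) ∈ U
    rw [affineChart_symm_affineChart hk]
    exact hγ ht
  obtain ⟨a, ha⟩ := H.planar t ht k hk
  obtain ⟨b, hb⟩ := h k _ hz _ (H.immersed t ht k hk)
  obtain ⟨c, hc⟩ := h' k _ hz _ (H.immersed t ht k hk)
  refine ⟨a - b + c, ?_⟩
  rw [hb] at ha
  rw [hc, add_smul, sub_smul, ← ha]
  abel

theorem isPlanar_metricOf {C : Matrix (Fin 3) (Fin 3) ℂ} (hC : C.IsHermitian) {U : Set CP2}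
    (hU : U ⊆ regularSet C) : IsPlanar (leviCivita (metricOf C)) U := fun k z hz u _ => by
  rw [leviCivita_metricOf hC ((symm_mem_regularSet_iff C _ _).1 (hU hz)), christoffelOf,
    ← add_smul, ← neg_smul]
  exact ⟨_, rfl⟩

theorem isHermitian_neg_one {n : Type*} [DecidableEq n] : (-1 : Matrix n n ℂ).IsHermitian := by
  simp [Matrix.IsHermitian]

theorem discr_neg_one (v : C3) : (discr (-1) v : ℂ) = herm v v := by
  have hadj : (-1 : Matrix (Fin 3) (Fin 3) ℂ).adjugate = 1 := by
    rw [← neg_one_smul ℂ, Matrix.adjugate_smul, Matrix.adjugate_one]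
    simp
  rw [ofReal_discr isHermitian_neg_one, adjForm_apply, hadj, Matrix.one_mulVec, herm,
    dotProduct_comm]

open scoped ComplexOrder in
theorem discr_neg_one_ne_zero {v : C3} (hv : v ≠ 0) : discr (-1) v ≠ 0 := by
  rw [← Complex.ofReal_ne_zero, discr_neg_one, herm]
  exact fun h => hv (dotProduct_self_star_eq_zero.1 h)

theorem regularSet_neg_one : regularSet (-1) = Set.univ :=
  Set.eq_univ_of_forall fun _ => discr_neg_one_ne_zero (homog_ne_zero _ _)

theorem fubiniStudy_eq : fubiniStudy = metricOf (-1) := by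
  funext p
  refine LinearMap.ext fun a => LinearMap.ext fun b => ?_
  change (_ / _ : ℂ).re = (_ / _ : ℂ).re
  rw [discr_neg_one]
  congr 2
  rw [Matrix.neg_mulVec, Matrix.one_mulVec, dotProduct_neg, neg_neg, star_cross, cross_dot_cross]
  simp only [herm]
  ring

theorem isPlanar_fubiniStudy (U : Set CP2) : IsPlanar (leviCivita fubiniStudy) U := by
  rw [fubiniStudy_eq]
  exact isPlanar_metricOf isHermitian_neg_one (regularSet_neg_one ▸ Set.subset_univ U)

theorem isCompatibleMetric_metricOf {C : Matrix (Fin 3) (Fin 3) ℂ} (hC : C.IsHermitian)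
    {U : Set CP2} (hU : U ⊆ regularSet C) : IsCompatibleMetric (metricOf C) U :=
  ⟨isPseudoKahler_metricOf hC hU, fun _ _ _ _ hγ =>
    ⟨(isPlanar_metricOf hC hU).isGeneralisedGeodesic (isPlanar_fubiniStudy U) hγ,
      (isPlanar_fubiniStudy U).isGeneralisedGeodesic (isPlanar_metricOf hC hU) hγ⟩⟩

end Planar

section Lines

variable (k l : Fin 3) (z u : C2)

theorem deriv_deriv_affineChart_chartLine {t : ℝ} (h : homog k (z + t • u) l ≠ 0) :
    deriv (deriv (affineChart l ∘ chartLine k z u)) t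
      = (-2 * direction k u l / homog k (z + t • u) l)
        • deriv (affineChart l ∘ chartLine k z u) t := by
  have hv := hasDerivAt_pi.1 (hasDerivAt_homog_line k z u t) l
  have hderiv : deriv (affineChart l ∘ chartLine k z u) =ᶠ[𝓝 t] fun s : ℝ =>
      (homog k (z + s • u) l ^ 2)⁻¹ • chartProj l (homog k z) (direction k u) := by
    filter_upwards [hv.continuousAt.eventually_ne h] with s hs
    exact (hasDerivAt_affineChart_chartLine k z u hs).deriv
  rw [hderiv.deriv_eq, (hasDerivAt_affineChart_chartLine k z u h).deriv, smul_smul]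
  refine (((hv.pow 2).inv (pow_ne_zero 2 h)).smul_const _).deriv.trans ?_
  congr 1
  simp only [Pi.pow_apply, Nat.cast_ofNat, Nat.add_one_sub_one, pow_one]
  field_simp

variable {u} in
theorem deriv_affineChart_chartLine_ne_zero (hu : u ≠ 0) {t : ℝ}
    (h : homog k (z + t • u) l ≠ 0) : deriv (affineChart l ∘ chartLine k z u) t ≠ 0 := by
  rw [(hasDerivAt_affineChart_chartLine k z u h).deriv, ← chartProj_homog_add_smul k l z u t]
  exact smul_ne_zero (inv_ne_zero (pow_ne_zero 2 h))
    (mt (eq_zero_of_chartProj_direction_eq_zero h) hu)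

theorem contMDiff_chartLine : ContMDiff 𝓘(ℝ, ℝ) 𝓘(ℝ, C2) ∞ (chartLine k z u) := by
  have hsymm : ContMDiffOn 𝓘(ℝ, C2) 𝓘(ℝ, C2) ∞ (affineChart k).symm (affineChart k).target :=
    contMDiffOn_symm_of_mem_maximalAtlas (IsManifold.subset_maximalAtlas (Set.mem_range_self k))
  have hline : ContMDiff 𝓘(ℝ, ℝ) 𝓘(ℝ, C2) ∞ fun t : ℝ => z + t • u :=
    (contDiff_const.add (contDiff_id.smul contDiff_const)).contMDiff
  exact hsymm.comp_contMDiff hline fun t => Set.mem_univ _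

variable {u} in
theorem isGeneralisedGeodesic_chartLine {Γ : Christoffel} {U : Set CP2} (hΓ : IsPlanar Γ U)
    (hu : u ≠ 0) {I : Set ℝ} (hI : Set.MapsTo (chartLine k z u) I U) :
    IsGeneralisedGeodesic Γ I (chartLine k z u) := by
  refine ⟨(contMDiff_chartLine k z u).contMDiffOn, fun t _ l hl => ?immersed,
    fun t ht l hl => ?planar⟩
  all_goals
    have hne := (chartLine_mem_source_iff k l z u t).1 hl
    have himm := deriv_affineChart_chartLine_ne_zero k l z hu hne
  case immersed => exact himm
  have hz : affineChart l (chartLine k z u t) ∈ coordDomain U l := by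
    rw [coordDomain, Set.mem_preimage, affineChart_symm_affineChart hl]
    exact hI ht
  obtain ⟨c, hc⟩ := hΓ l _ hz _ himm
  rw [hc, deriv_deriv_affineChart_chartLine k l z u hne, ← add_smul]
  exact ⟨_, rfl⟩

theorem isPlanar_of_equivalent {Γ : Christoffel} {U : Set CP2} (hU : IsOpen U)
    (h : ComplexProjectivelyEquivalent Γ (leviCivita fubiniStudy) U) : IsPlanar Γ U := by
  intro k z hz u hu
  have h₀ : chartLine k z u 0 ∈ U := by simpa [chartLine] using! hz
  obtain ⟨ε, hε, hball⟩ :=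
    Metric.isOpen_iff.1 (hU.preimage (contMDiff_chartLine k z u).continuous) 0 h₀
  have hconn : (Metric.ball (0 : ℝ) ε).OrdConnected :=
    Real.ball_eq_Ioo (0 : ℝ) ε ▸ Set.ordConnected_Ioo
  have hgeo := (h _ _ Metric.isOpen_ball hconn hball).2
    (isGeneralisedGeodesic_chartLine k z (isPlanar_fubiniStudy U) hu hball)
  have hline : affineChart k ∘ chartLine k z u = fun t : ℝ => z + t • u :=
    funext fun t => affineChart_affineChart_symm k _
  have hderiv : deriv (affineChart k ∘ chartLine k z u) = fun _ => u := by
    rw [hline]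
    exact funext fun t => (hasDerivAt_line z u t).deriv
  have hpoint : affineChart k (chartLine k z u 0) = z := by simpa using congrFun hline 0
  obtain ⟨c, hc⟩ := hgeo.planar 0 (Metric.mem_ball_self hε) k
    ((affineChart k).map_target (Set.mem_univ _))
  rw [hderiv, hpoint, deriv_const, zero_add] at hc
  exact ⟨c, hc⟩

end Lines

section Connection

variable {K V : Type*} [Field K] [NeZero (2 : K)] [AddCommGroup V] [Module K V]

theorem exists_symmetric_metric_connection [FiniteDimensional K V] {B : LinearMap.BilinForm K V}
    (hB : B.Nondegenerate) (hBsymm : ∀ u w, B u w = B w u) {D : V →ₗ[K] V →ₗ[K] V →ₗ[K] K}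
    (hDsymm : ∀ u w, D u w = D w u) :
    ∃ Γ : V →ₗ[K] V →ₗ[K] V, (∀ u w, Γ u w = Γ w u) ∧
      ∀ u w y, D w y u = B (Γ u w) y + B w (Γ u y) := by
  let E : V →ₗ[K] V →ₗ[K] V →ₗ[K] K := LinearMap.lflip.toLinearMap ∘ₗ D
  let β : (V →ₗ[K] K) →ₗ[K] V := (B.toDual hB).symm.toLinearMap
  have hβ : ∀ ξ y, B (β ξ) y = ξ y := fun ξ y =>
    LinearMap.BilinForm.apply_toDual_symm_apply ξ y
  let Γ : V →ₗ[K] V →ₗ[K] V := (2 : K)⁻¹ • (E.flip.compr₂ β + E.compr₂ β - D.compr₂ β)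
  have hΓ : ∀ u w y, B (Γ u w) y = 2⁻¹ * (D w y u + D u y w - D u w y) := fun u w y => by
    simp only [Γ, LinearMap.smul_apply, LinearMap.add_apply, LinearMap.sub_apply,
      LinearMap.compr₂_apply, map_smul, map_add, map_sub, hβ, smul_eq_mul]
    rfl
  have hcomm : ∀ u w, Γ u w = Γ w u := fun u w => by
    simp only [Γ, LinearMap.smul_apply, LinearMap.add_apply, LinearMap.sub_apply,
      LinearMap.compr₂_apply, LinearMap.flip_apply, hDsymm u w, add_comm (β (E u w))]
  refine ⟨Γ, hcomm, fun u w y => ?_⟩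
  rw [hBsymm w, hΓ, hΓ, hDsymm y w]
  have h2 : (2 : K) ≠ 0 := two_ne_zero
  field_simp
  ring

theorem two_smul_eq_of_apply_self_eq_smul {Γ : V →ₗ[K] V →ₗ[K] V} (hsymm : ∀ u w, Γ u w = Γ w u)
    {c : V → K} (hc : ∀ u, Γ u u = c u • u) (hc₀ : c 0 = 0) (u w : V) :
    (2 : K) • Γ u w = c u • w + c w • u := by
  rcases eq_or_ne u 0 with rfl | hu
  · simp [hc₀]
  by_cases hw : ∃ a : K, a • u = w
  · obtain ⟨a, rfl⟩ := hw
    rcases eq_or_ne a 0 with rfl | ha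
    · simp [hc₀]
    have hcau := hc (a • u)
    rw [map_smul, LinearMap.map_smul₂, hc, smul_comm (c (a • u))] at hcau
    rw [← smul_right_injective V ha hcau, map_smul, hc]
    module
  · have hadd := hc (u + w)
    have hsub := hc (u - w)
    simp only [map_add, map_sub, LinearMap.add_apply, LinearMap.sub_apply, hc u, hc w,
      hsymm w u] at hadd hsub
    obtain ⟨hcu, hcw⟩ := LinearIndependent.pair_iff.1
      ((LinearIndependent.pair_iff' hu).2 (not_exists.1 hw)) (2 * c u - c (u + w) - c (u - w))
      (2 * c w - c (u + w) + c (u - w)) (by linear_combination (norm := module) hadd + hsub)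
    have hcadd : c (u + w) = c u + c w :=
      mul_left_cancel₀ (two_ne_zero (α := K)) (by linear_combination -hcu - hcw)
    rw [hcadd] at hadd
    linear_combination (norm := module) hadd

theorem exists_dual_of_apply_self_mem_span {Γ : V →ₗ[K] V →ₗ[K] V}
    (hsymm : ∀ u w, Γ u w = Γ w u) (h : ∀ u, u ≠ 0 → ∃ c : K, Γ u u = c • u) :
    ∃ φ : Module.Dual K V, ∀ u w, Γ u w = φ u • w + φ w • u := by
  have hex : ∀ u, ∃ c : K, Γ u u = c • u ∧ (u = 0 → c = 0) := fun u => by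
    rcases eq_or_ne u 0 with rfl | hu
    · exact ⟨0, by simp⟩
    · exact (h u hu).imp fun c hc => ⟨hc, fun hu' => absurd hu' hu⟩
  choose c hc hc₀ using hex
  have hΓ := two_smul_eq_of_apply_self_eq_smul hsymm hc (hc₀ 0 rfl)
  rcases subsingleton_or_nontrivial V with hV | hV
  · exact ⟨0, fun u w => Subsingleton.elim _ _⟩
  obtain ⟨y, hy⟩ := exists_ne (0 : V)
  let c' : Module.Dual K V :=
    { toFun := c
      map_add' := fun u w => smul_left_injective K hy (by
        have huw := hΓ (u + w) y
        rw [map_add, LinearMap.add_apply, smul_add, hΓ, hΓ] at huw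
        linear_combination (norm := module) -huw)
      map_smul' := fun a u => smul_left_injective K hy (by
        have hau := hΓ (a • u) y
        rw [map_smul, LinearMap.smul_apply, smul_comm, hΓ] at hau
        simp only [RingHom.id_apply]
        linear_combination (norm := module) -hau) }
  refine ⟨(2 : K)⁻¹ • c', fun u w => ?_⟩
  rw [← inv_smul_smul₀ (two_ne_zero (α := K)) (Γ u w), hΓ]
  simp only [LinearMap.smul_apply, smul_add, smul_smul, smul_eq_mul]
  rfl

end Connection

section LeviCivita

theorem exists_linearMap_fderiv_apply {E V : Type*} [NormedAddCommGroup E] [NormedSpace ℝ E]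
    [AddCommGroup V] [Module ℝ V] {B : E → LinearMap.BilinForm ℝ V} {x₀ : E}
    (hB : ∀ u w, DifferentiableAt ℝ (fun x => B x u w) x₀) :
    ∃ D : V →ₗ[ℝ] V →ₗ[ℝ] E →ₗ[ℝ] ℝ, ∀ u w e, D u w e = fderiv ℝ (fun x => B x u w) x₀ e :=
  ⟨LinearMap.mk₂ ℝ (fun u w => (fderiv ℝ (fun x => B x u w) x₀ : E →ₗ[ℝ] ℝ))
    (fun u u' w => by simp [fderiv_fun_add (hB u w) (hB u' w)])
    (fun c u w => by simp [fderiv_const_mul (hB u w)])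
    (fun u w w' => by simp [fderiv_fun_add (hB u w) (hB u w')])
    (fun c u w => by simp [fderiv_const_mul (hB u w)]), fun _ _ _ => rfl⟩

theorem complex_smul_eq {V : Type*} [AddCommGroup V] [Module ℂ V] [Module ℝ V]
    [IsScalarTower ℝ ℂ V] (c : ℂ) (v : V) : c • v = c.re • v + c.im • Complex.I • v := by
  rw [← algebraMap_smul ℂ c.re, ← algebraMap_smul ℂ c.im, smul_smul, ← add_smul,
    Complex.coe_algebraMap, Complex.re_add_im]

theorem exists_complex_bilinear {V W : Type*} [AddCommGroup V] [Module ℂ V] [Module ℝ V]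
    [IsScalarTower ℝ ℂ V] [AddCommGroup W] [Module ℂ W] [Module ℝ W] [IsScalarTower ℝ ℂ W]
    {Γ : V →ₗ[ℝ] V →ₗ[ℝ] W} (hsymm : ∀ u w, Γ u w = Γ w u)
    (hI : ∀ u w, Γ u (Complex.I • w) = Complex.I • Γ u w) :
    ∃ Γ' : V →ₗ[ℂ] V →ₗ[ℂ] W, ∀ u w, Γ' u w = Γ u w := by
  have hsmul : ∀ (c : ℂ) u w, Γ u (c • w) = c • Γ u w := fun c u w => by
    rw [complex_smul_eq, map_add, map_smul, map_smul, hI, ← complex_smul_eq]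
  exact ⟨LinearMap.mk₂ ℂ (fun u w => Γ u w) (fun u u' w => by rw [map_add, LinearMap.add_apply])
    (fun c u w => by rw [hsymm, hsmul, hsymm]) (fun u w w' => map_add _ _ _) hsmul,
    fun _ _ => rfl⟩

variable {g : BilinField} {U : Set CP2} {k : Fin 3} {z : C2}

theorem IsPseudoKahler.differentiableAt (hg : IsPseudoKahler g U) (hU : IsOpen U)
    (hz : z ∈ coordDomain U k) (u w : C2) :
    DifferentiableAt ℝ (fun x => g.inChart k x u w) z :=
  ((hg.smooth k u w).contDiffAt ((isOpen_coordDomain k hU).mem_nhds hz)).differentiableAt (by simp)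

theorem IsPseudoKahler.inChart_comm (hg : IsPseudoKahler g U) (hz : z ∈ coordDomain U k)
    (u w : C2) : g.inChart k z u w = g.inChart k z w u :=
  hg.symm _ hz _ _

theorem IsPseudoKahler.exists_bilinear_leviCivita (hg : IsPseudoKahler g U) (hU : IsOpen U)
    (hz : z ∈ coordDomain U k) :
    ∃ Γ : C2 →ₗ[ℝ] C2 →ₗ[ℝ] C2, (∀ u w, Γ u w = leviCivita g k z u w) ∧
      (∀ u w, Γ u w = Γ w u) ∧ ∀ u w y, fderiv ℝ (fun x => g.inChart k x w y) z u
        = g.inChart k z (Γ u w) y + g.inChart k z w (Γ u y) := by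
  obtain ⟨D, hD⟩ :=
    exists_linearMap_fderiv_apply (B := fun x => chartForm g k x) (hg.differentiableAt hU hz)
  have hDsymm : ∀ u w, D u w = D w u := fun u w => LinearMap.ext fun e => by
    have hev : (fun x => g.inChart k x u w) =ᶠ[𝓝 z] fun x => g.inChart k x w u :=
      ((isOpen_coordDomain k hU).eventually_mem hz).mono fun x hx => hg.inChart_comm hx u w
    rw [hD, hD]
    exact DFunLike.congr_fun hev.fderiv_eq e
  have hnd : (chartForm g k z).Nondegenerate := by
    refine ⟨inChart_nondegenerate hg.nondegenerate hz, fun u hu => ?_⟩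
    refine inChart_nondegenerate hg.nondegenerate hz u fun w => ?_
    rw [hg.inChart_comm hz]
    exact hu w
  obtain ⟨Γ, hΓ, hmetric⟩ :=
    exists_symmetric_metric_connection hnd (hg.inChart_comm hz) hDsymm
  simp only [hD] at hmetric
  exact ⟨Γ, fun u w => (leviCivita_eq (inChart_nondegenerate hg.nondegenerate hz)
    (IsKoszul.of_fderiv_eq (hg.inChart_comm hz) hΓ hmetric u w)).symm, hΓ, hmetric⟩

theorem IsPseudoKahler.exists_dual_fderiv_eq (hg : IsPseudoKahler g U) (hU : IsOpen U)
    (hΓ : IsPlanar (leviCivita g) U) (hz : z ∈ coordDomain U k) :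
    ∃ φ : Module.Dual ℂ C2, ∀ u w y, fderiv ℝ (fun x => g.inChart k x w y) z u
      = g.inChart k z (φ u • w + φ w • u) y + g.inChart k z w (φ u • y + φ y • u) := by
  obtain ⟨Γ, hleviCivita, hsymm, hmetric⟩ := hg.exists_bilinear_leviCivita hU hz
  obtain ⟨Γ', hΓ'⟩ := exists_complex_bilinear hsymm fun u w => by
    simp only [hleviCivita]
    exact hg.parallel k z hz u w
  obtain ⟨φ, hφ⟩ := exists_dual_of_apply_self_mem_span (Γ := Γ')
    (fun u w => by rw [hΓ', hΓ', hsymm])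
    (fun u hu => by simpa only [hΓ', hleviCivita] using hΓ k z hz u hu)
  exact ⟨φ, fun u w y => by rw [hmetric, ← hΓ', ← hΓ', hφ, hφ]⟩

end LeviCivita

section HermitianPart

theorem I_smul_I_smul {V : Type*} [AddCommGroup V] [Module ℂ V] (v : V) :
    Complex.I • Complex.I • v = -v := by
  rw [smul_smul, Complex.I_mul_I, neg_one_smul]

variable {V : Type*} [AddCommGroup V] [Module ℂ V] [Module ℝ V] [IsScalarTower ℝ ℂ V]

/-- The sesquilinear form whose real part is the `Complex.I`-invariant part of the real bilinear
form `B`. -/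
def hermitianPart (B : LinearMap.BilinForm ℝ V) : V →ₗ[ℂ] V →ₗ⋆[ℂ] ℂ :=
  LinearMap.mk₂'ₛₗ (RingHom.id ℂ) (starRingEnd ℂ)
    (fun u w => ⟨(B u w + B (Complex.I • u) (Complex.I • w)) / 2,
      (B u (Complex.I • w) - B (Complex.I • u) w) / 2⟩)
    (fun u u' w => by
      apply Complex.ext <;> simp only [smul_add, map_add, LinearMap.add_apply, Complex.add_re,
        Complex.add_im] <;> ring)
    (fun c u w => by
      apply Complex.ext <;> simp only [complex_smul_eq c u, smul_add, smul_comm Complex.I,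
        I_smul_I_smul, smul_neg, map_add, map_smul, map_neg, LinearMap.add_apply,
        LinearMap.smul_apply, LinearMap.neg_apply, smul_eq_mul, RingHom.id_apply, Complex.mul_re,
        Complex.mul_im] <;> ring)
    (fun u w w' => by
      apply Complex.ext <;> simp only [smul_add, map_add, Complex.add_re, Complex.add_im] <;> ring)
    (fun c u w => by
      apply Complex.ext <;> simp only [complex_smul_eq c w, smul_add, smul_comm Complex.I,
        I_smul_I_smul, smul_neg, map_add, map_smul, map_neg, smul_eq_mul, Complex.mul_re,
        Complex.mul_im, Complex.conj_re, Complex.conj_im] <;> ring)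

theorem hermitianPart_apply (B : LinearMap.BilinForm ℝ V) (u w : V) :
    hermitianPart B u w = ⟨(B u w + B (Complex.I • u) (Complex.I • w)) / 2,
      (B u (Complex.I • w) - B (Complex.I • u) w) / 2⟩ := rfl

theorem re_hermitianPart {B : LinearMap.BilinForm ℝ V}
    (hB : ∀ u w, B (Complex.I • u) (Complex.I • w) = B u w) (u w : V) :
    (hermitianPart B u w).re = B u w := by
  simp [hermitianPart_apply, hB]

theorem star_hermitianPart {B : LinearMap.BilinForm ℝ V} (hB : ∀ u w, B u w = B w u) (u w : V) :
    star (hermitianPart B u w) = hermitianPart B w u := by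
  rw [hermitianPart_apply, hermitianPart_apply, hB u, hB u, hB (Complex.I • u),
    hB (Complex.I • u)]
  apply Complex.ext <;> simp only [RCLike.star_def, Complex.conj_re, Complex.conj_im]
  ring

theorem hasDerivAt_hermitianPart {B : ℝ → LinearMap.BilinForm ℝ V} {t : ℝ} {A : V →ₗ[ℂ] V}
    (hB : ∀ u w, HasDerivAt (fun s => B s u w) (B t (A u) w + B t u (A w)) t) (u w : V) :
    HasDerivAt (fun s => hermitianPart (B s) u w)
      (hermitianPart (B t) (A u) w + hermitianPart (B t) u (A w)) t := by
  have hre := ((hB u w).add (hB (Complex.I • u) (Complex.I • w))).div_const 2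
  have him := ((hB u (Complex.I • w)).sub (hB (Complex.I • u) w)).div_const 2
  have h := (hre.ofReal_comp.add (him.ofReal_comp.mul_const Complex.I)).congr_deriv
    (g' := hermitianPart (B t) (A u) w + hermitianPart (B t) u (A w)) <| by
      apply Complex.ext <;> simp [hermitianPart_apply] <;> ring
  refine h.congr_of_eventuallyEq (Eventually.of_forall fun s => ?_)
  apply Complex.ext <;> simp [hermitianPart_apply]

end HermitianPart

section Weight

theorem hasDerivAt_det_hform_symm {H : ℝ → C2 →ₗ[ℂ] C2 →ₗ⋆[ℂ] ℂ} {t : ℝ} {A : C2 →ₗ[ℂ] C2}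
    (hH : ∀ u w, HasDerivAt (fun s => H s u w) (H t (A u) w + H t u (A w)) t) :
    HasDerivAt (fun s => (hform.symm (H s)).det)
      ((LinearMap.trace ℂ C2 A + conj (LinearMap.trace ℂ C2 A)) * (hform.symm (H t)).det) t := by
  have hA : ∀ u, A u = A u 0 • Pi.single 0 1 + A u 1 • Pi.single 1 1 := fun u => by
    simpa using pi_eq_sum_univ' (A u)
  have htrace : LinearMap.trace ℂ C2 A = A (Pi.single 0 1) 0 + A (Pi.single 1 1) 1 := by
    simp [LinearMap.trace_eq_matrix_trace ℂ (Pi.basisFun ℂ (Fin 2)), Matrix.trace_fin_two]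
  simp only [Matrix.det_fin_two, hform_symm_apply]
  refine (((hH _ _).mul (hH _ _)).sub ((hH _ _).mul (hH _ _))).congr_deriv ?_
  rw [htrace, hA (Pi.single 0 1), hA (Pi.single 1 1)]
  simp only [map_add, map_smulₛₗ, LinearMap.add_apply, LinearMap.smul_apply, RingHom.id_apply,
    smul_eq_mul, Pi.add_apply, Pi.smul_apply, Pi.single_eq_same, mul_one, ne_eq, zero_ne_one,
    one_ne_zero, not_false_eq_true, Pi.single_eq_of_ne, mul_zero, add_zero, zero_add]
  ring

theorem hasDerivAt_cube_div_det_sq {H : ℝ → C2 →ₗ[ℂ] C2 →ₗ⋆[ℂ] ℂ} {t : ℝ}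
    {φ : Module.Dual ℂ C2} {u : C2} (hdet : (hform.symm (H t)).det ≠ 0)
    (hH : ∀ w y, HasDerivAt (fun s => H s w y)
      (H t (φ u • w + φ w • u) y + H t w (φ u • y + φ y • u)) t) :
    HasDerivAt (fun s => H s u u ^ 3 / (hform.symm (H s)).det ^ 2) 0 t := by
  let A : C2 →ₗ[ℂ] C2 := φ u • LinearMap.id + φ.smulRight u
  have htrace : LinearMap.trace ℂ C2 A = 3 * φ u := by
    simp only [A, map_add, map_smul, LinearMap.trace_id, LinearMap.trace_smulRight,
      Module.finrank_fintype_fun_eq_card, Fintype.card_fin, Nat.cast_ofNat, smul_eq_mul]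
    ring
  refine (((hH u u).pow 3).div ((hasDerivAt_det_hform_symm (A := A) hH).pow 2)
    (pow_ne_zero 2 hdet)).congr_deriv ?_
  rw [div_eq_zero_iff, htrace]
  left
  simp only [Pi.pow_apply, map_add, map_mul, map_smulₛₗ, LinearMap.add_apply,
    LinearMap.smul_apply, smul_eq_mul, RingHom.id_apply, Complex.conj_ofNat]
  push_cast
  ring

/-- The hermitian form whose real part is `g` in the `k`-th affine chart, for a hermitian `g`. -/
def chartHerm (g : BilinField) (k : Fin 3) (z : C2) : C2 →ₗ[ℂ] C2 →ₗ⋆[ℂ] ℂ :=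
  hermitianPart (chartForm g k z)

variable {g : BilinField} {U : Set CP2} {k : Fin 3} {z : C2}

theorem IsPseudoKahler.re_chartHerm (hg : IsPseudoKahler g U) (hz : z ∈ coordDomain U k)
    (u w : C2) : (chartHerm g k z u w).re = g.inChart k z u w :=
  re_hermitianPart (B := chartForm g k z) (inChart_I_I hg.hermitian hz) u w

theorem IsPseudoKahler.star_chartHerm (hg : IsPseudoKahler g U) (hz : z ∈ coordDomain U k)
    (u w : C2) : star (chartHerm g k z u w) = chartHerm g k z w u :=
  star_hermitianPart (hg.inChart_comm hz) u w

theorem IsPseudoKahler.det_chartHerm_ne_zero (hg : IsPseudoKahler g U)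
    (hz : z ∈ coordDomain U k) : (hform.symm (chartHerm g k z)).det ≠ 0 :=
  det_hform_symm_ne_zero_iff.2 fun u hu => inChart_nondegenerate hg.nondegenerate hz u fun w => by
    rw [← hg.re_chartHerm hz, hu, Complex.zero_re]

theorem IsPseudoKahler.exists_dual_hasDerivAt_chartHerm (hg : IsPseudoKahler g U) (hU : IsOpen U)
    (hΓ : IsPlanar (leviCivita g) U) {u : C2} {t : ℝ} (hz : z + t • u ∈ coordDomain U k) :
    ∃ φ : Module.Dual ℂ C2, ∀ w y, HasDerivAt (fun s : ℝ => chartHerm g k (z + s • u) w y)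
      (chartHerm g k (z + t • u) (φ u • w + φ w • u) y
        + chartHerm g k (z + t • u) w (φ u • y + φ y • u)) t := by
  obtain ⟨φ, hφ⟩ := hg.exists_dual_fderiv_eq hU hΓ hz
  let A : C2 →ₗ[ℂ] C2 := φ u • LinearMap.id + φ.smulRight u
  have hA : ∀ w, A w = φ u • w + φ w • u := fun _ => rfl
  have hderiv : ∀ w y, HasDerivAt (fun s : ℝ => chartForm g k (z + s • u) w y)
      (chartForm g k (z + t • u) (A w) y + chartForm g k (z + t • u) w (A y)) t := fun w y =>
    (HasFDerivAt.comp_hasDerivAt (l := fun x => g.inChart k x w y) t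
      (hg.differentiableAt hU hz w y).hasFDerivAt (hasDerivAt_line z u t)).congr_deriv (hφ u w y)
  exact ⟨φ, fun w y => by simpa only [chartHerm, hA] using hasDerivAt_hermitianPart hderiv w y⟩

theorem IsPseudoKahler.chartHerm_cube_eq (hg : IsPseudoKahler g U) (hU : IsOpen U)
    (hΓ : IsPlanar (leviCivita g) U) {s : Set C2} (hs : Convex ℝ s) (hsU : s ⊆ coordDomain U k)
    {y : C2} (hz : z ∈ s) (hy : y ∈ s) :
    chartHerm g k y (y - z) (y - z) ^ 3 / (hform.symm (chartHerm g k y)).det ^ 2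
      = chartHerm g k z (y - z) (y - z) ^ 3 / (hform.symm (chartHerm g k z)).det ^ 2 := by
  let u := y - z
  have hderiv : ∀ t ∈ Set.Icc (0 : ℝ) 1, HasDerivAt (fun t : ℝ =>
      chartHerm g k (z + t • u) u u ^ 3 / (hform.symm (chartHerm g k (z + t • u))).det ^ 2) 0 t :=
    fun t ht => by
      have hzt : z + t • u ∈ coordDomain U k := hsU (hs.add_smul_sub_mem hz hy ht)
      obtain ⟨φ, hφ⟩ := hg.exists_dual_hasDerivAt_chartHerm hU hΓ hzt
      exact hasDerivAt_cube_div_det_sq (hg.det_chartHerm_ne_zero hzt) hφ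
  have hconst := constant_of_has_deriv_right_zero
    (fun t ht => (hderiv t ht).continuousAt.continuousWithinAt)
    (fun t ht => (hderiv t ⟨ht.1, ht.2.le⟩).hasDerivWithinAt) 1 ⟨zero_le_one, le_rfl⟩
  simpa [u] using hconst

end Weight

section LocalForm

theorem exists_cube_eq (x : ℝ) : ∃ r : ℝ, r ^ 3 = x := by
  rcases le_total 0 x with hx | hx
  · exact ⟨x ^ ((3 : ℕ) : ℝ)⁻¹, Real.rpow_inv_natCast_pow hx (by norm_num)⟩
  · refine ⟨-(-x) ^ ((3 : ℕ) : ℝ)⁻¹, ?_⟩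
    rw [Odd.neg_pow (by decide), Real.rpow_inv_natCast_pow (by linarith) (by norm_num), neg_neg]

variable {g : BilinField} {U : Set CP2} {k : Fin 3} {z : C2}

theorem IsPseudoKahler.exists_cube_mul_det_eq_one (hg : IsPseudoKahler g U)
    (hz : z ∈ coordDomain U k) :
    ∃ r : ℝ, (r : ℂ) ^ 3 * (hform.symm (chartHerm g k z)).det = 1 := by
  have hreal : conj (hform.symm (chartHerm g k z)).det = (hform.symm (chartHerm g k z)).det := by
    simp only [Matrix.det_fin_two, hform_symm_apply, map_sub, map_mul, starRingEnd_apply,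
      hg.star_chartHerm hz]
    ring
  have hdet := hg.det_chartHerm_ne_zero hz
  rw [← Complex.conj_eq_iff_re.1 hreal] at hdet ⊢
  obtain ⟨r, hr⟩ := exists_cube_eq (hform.symm (chartHerm g k z)).det.re⁻¹
  refine ⟨r, ?_⟩
  rw [← Complex.ofReal_pow, hr, Complex.ofReal_inv, inv_mul_cancel₀ hdet]

theorem IsPseudoKahler.sq_mul_chartHerm_eq (hg : IsPseudoKahler g U) (hU : IsOpen U)
    (hΓ : IsPlanar (leviCivita g) U) {s : Set C2} (hs : Convex ℝ s) (hsU : s ⊆ coordDomain U k)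
    {r : C2 → ℝ} (hr : ∀ z ∈ s, (r z : ℂ) ^ 3 * (hform.symm (chartHerm g k z)).det = 1)
    {y : C2} (hz : z ∈ s) (hy : y ∈ s) :
    (r y : ℂ) ^ 2 * chartHerm g k y (y - z) (y - z)
      = (r z : ℂ) ^ 2 * chartHerm g k z (y - z) (y - z) := by
  have hweight : ∀ x ∈ s, ∀ u, chartHerm g k x u u ^ 3 / (hform.symm (chartHerm g k x)).det ^ 2
      = (((r x ^ 2 * (chartHerm g k x u u).re) ^ 3 : ℝ) : ℂ) := fun x hx u => by
    have hreal := Complex.conj_eq_iff_re.1 (hg.star_chartHerm (hsU hx) u u)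
    push_cast
    rw [hreal, div_eq_iff (pow_ne_zero 2 (hg.det_chartHerm_ne_zero (hsU hx)))]
    linear_combination (-(chartHerm g k x u u) ^ 3
      * ((r x : ℂ) ^ 3 * (hform.symm (chartHerm g k x)).det + 1)) * hr x hx
  have hcube := hg.chartHerm_cube_eq hU hΓ hs hsU hz hy
  rw [hweight y hy, hweight z hz, Complex.ofReal_inj] at hcube
  have hsq := (Odd.strictMono_pow (by decide : Odd 3)).injective hcube
  rw [← Complex.conj_eq_iff_re.1 (hg.star_chartHerm (hsU hy) _ _),
    ← Complex.conj_eq_iff_re.1 (hg.star_chartHerm (hsU hz) _ _)]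
  exact_mod_cast hsq

theorem IsPseudoKahler.exists_crossForm_eq (hg : IsPseudoKahler g U) (hU : IsOpen U)
    (hΓ : IsPlanar (leviCivita g) U) {z₀ : C2} (hz₀ : z₀ ∈ coordDomain U k) :
    ∃ C : Matrix (Fin 3) (Fin 3) ℂ, C.IsHermitian ∧ ∀ᶠ z in 𝓝 z₀, z ∈ coordDomain U k ∧
      ∃ r : ℝ, (r : ℂ) ^ 3 * (hform.symm (chartHerm g k z)).det = 1 ∧
        crossForm C k z = -(r : ℂ) ^ 2 • chartHerm g k z := by
  obtain ⟨ε, hε, hball⟩ := Metric.isOpen_iff.1 (isOpen_coordDomain k hU) z₀ hz₀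
  have hroot : ∀ z, ∃ r : ℝ, z ∈ Metric.ball z₀ ε →
      (r : ℂ) ^ 3 * (hform.symm (chartHerm g k z)).det = 1 := fun z => by
    by_cases hz : z ∈ Metric.ball z₀ ε
    · exact (hg.exists_cube_mul_det_eq_one (hball hz)).imp fun _ h _ => h
    · exact ⟨0, fun h => absurd h hz⟩
  choose r hr using hroot
  let m (z : Metric.ball z₀ ε) : C3 →ₗ[ℂ] C3 →ₗ⋆[ℂ] ℂ := -(r z : ℂ) ^ 2 •
    (chartHerm g k z ∘ₗ chartProj k (homog k z)).compl₂ (chartProj k (homog k z))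
  have hm : ∀ z v w, m z v w = -(r z : ℂ) ^ 2
      * chartHerm g k z (chartProj k (homog k z) v) (chartProj k (homog k z) w) :=
    fun _ _ _ => rfl
  obtain ⟨C, hC, hmC⟩ := exists_isHermitian_hform_cross_eq (m := m)
    (s := fun z : Metric.ball z₀ ε => homog k z.1)
    (eventually_eq_smul_homog k z₀ (Metric.ball_mem_nhds z₀ hε))
    (fun z => LinearMap.ext fun w => by simp [hm, chartProj_self])
    (fun z y => by
      rw [hm, hm, chartProj_homog_homog, chartProj_homog_homog, neg_mul, neg_mul,
        ← hg.sq_mul_chartHerm_eq hU hΓ (convex_ball z₀ ε) hball hr z.2 y.2, ← neg_sub y.1 z.1]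
      simp only [map_neg, LinearMap.neg_apply, neg_neg])
    (fun z u => by
      rw [hm, map_mul, map_neg, map_pow, Complex.conj_ofReal, starRingEnd_apply,
        hg.star_chartHerm (hball z.2)])
  refine ⟨C, hC, eventually_of_mem (Metric.ball_mem_nhds z₀ hε) fun z hz =>
    ⟨hball hz, r z, hr z hz, LinearMap.ext₂ fun u w => ?_⟩⟩
  have h := hmC ⟨z, hz⟩ (direction k u) (direction k w)
  rw [hm, chartProj_homog_direction, chartProj_homog_direction] at h
  rw [crossForm_apply, crossVec_apply, crossVec_apply, ← h]
  rfl

theorem IsPseudoKahler.exists_metricOf_eq (hg : IsPseudoKahler g U) (hU : IsOpen U)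
    (hΓ : IsPlanar (leviCivita g) U) {z₀ : C2} (hz₀ : z₀ ∈ coordDomain U k) :
    ∃ C : Matrix (Fin 3) (Fin 3) ℂ, C.IsHermitian ∧ ∀ᶠ z in 𝓝 z₀,
      discr C (homog k z) ≠ 0 ∧ ∀ u w, g.inChart k z u w = (metricOf C).inChart k z u w := by
  obtain ⟨C, hC, h⟩ := hg.exists_crossForm_eq hU hΓ hz₀
  refine ⟨C, hC, h.mono fun z ⟨hz, r, hr, hrC⟩ => ?_⟩
  have hr0 : (r : ℂ) ≠ 0 := fun h0 => by simp [h0] at hr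
  have hdiscr : discr C (homog k z) = r := by
    have hdet := det_hform_symm_crossForm hC k z
    rw [hrC, map_smul, Matrix.det_smul, Fintype.card_fin] at hdet
    exact Complex.ofReal_injective (by linear_combination -hdet + r * hr)
  refine ⟨fun h0 => hr0 (by rw [← hdiscr, h0, Complex.ofReal_zero]), fun u w => ?_⟩
  have hH : metricHerm C k z = chartHerm g k z := by
    rw [metricHerm, hrC, hdiscr, smul_smul, neg_mul_neg, inv_mul_cancel₀ (pow_ne_zero 2 hr0),
      one_smul]
  rw [inChart_metricOf, hH, hg.re_chartHerm hz]

end LocalForm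

section Uniqueness

theorem eq_of_re_apply_eq {V : Type*} [AddCommGroup V] [Module ℂ V] {B B' : V →ₗ[ℂ] V →ₗ⋆[ℂ] ℂ}
    (h : ∀ u w, (B u w).re = (B' u w).re) : B = B' := by
  refine LinearMap.ext₂ fun u w => Complex.ext (h u w) ?_
  simpa only [map_smulₛₗ, Complex.conj_I, neg_smul, smul_eq_mul, neg_mul, Complex.neg_re,
    Complex.I_mul_re, neg_neg] using h u (Complex.I • w)

theorem cross_eq_crossVec_chartProj (k : Fin 3) (z : C2) (u : C3) :
    homog k z ⨯₃ u = crossVec k z (chartProj k (homog k z) u) := by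
  rw [crossVec_apply, direction_chartProj, homog_self, one_smul, map_sub, map_smul, cross_self,
    smul_zero, sub_zero]

variable {C C' : Matrix (Fin 3) (Fin 3) ℂ} {k : Fin 3}

theorem det_hform_symm_metricHerm (hC : C.IsHermitian) (k : Fin 3) (z : C2) :
    (hform.symm (metricHerm C k z)).det = ((discr C (homog k z) : ℂ) ^ 3)⁻¹ := by
  rw [metricHerm, map_smul, Matrix.det_smul, Fintype.card_fin, det_hform_symm_crossForm hC]
  rcases eq_or_ne (discr C (homog k z) : ℂ) 0 with h | h
  · simp [h]
  · field_simp

theorem crossForm_eq_of_inChart_metricOf_eq (hC : C.IsHermitian) (hC' : C'.IsHermitian) {z : C2}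
    (hz : discr C (homog k z) ≠ 0)
    (h : ∀ u w, (metricOf C).inChart k z u w = (metricOf C').inChart k z u w) :
    crossForm C k z = crossForm C' k z := by
  have hmetric : metricHerm C k z = metricHerm C' k z :=
    eq_of_re_apply_eq fun u w => by rw [← inChart_metricOf, ← inChart_metricOf, h]
  have hdet := congrArg (fun B => (hform.symm B).det) hmetric
  simp only [det_hform_symm_metricHerm hC, det_hform_symm_metricHerm hC', inv_inj] at hdet
  have hdiscr : discr C (homog k z) = discr C' (homog k z) :=
    (Odd.strictMono_pow (by decide : Odd 3)).injective (by exact_mod_cast hdet)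
  rw [metricHerm, metricHerm, ← hdiscr] at hmetric
  exact smul_right_injective _
    (neg_ne_zero.2 (inv_ne_zero (pow_ne_zero 2 (Complex.ofReal_ne_zero.2 hz)))) hmetric

theorem eq_of_inChart_metricOf_eq (hC : C.IsHermitian) (hC' : C'.IsHermitian) {z₀ : C2}
    (h : ∀ᶠ z in 𝓝 z₀, discr C (homog k z) ≠ 0 ∧
      ∀ u w, (metricOf C).inChart k z u w = (metricOf C').inChart k z u w) : C = C' := by
  refine sub_eq_zero.1 <| eq_zero_of_hform_cross_self (eventually_eq_smul_homog k z₀ h)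
    fun z u => ?_
  have hcross := crossForm_eq_of_inChart_metricOf_eq hC hC' z.2.1 z.2.2
  rw [cross_eq_crossVec_chartProj, map_sub, LinearMap.sub_apply, LinearMap.sub_apply,
    ← crossForm_apply, ← crossForm_apply, hcross, sub_self]

theorem adjugate_ne_zero_of_two_le_rank (h : 2 ≤ C.rank) : C.adjugate ≠ 0 := by
  intro hadj
  have hminor : ∀ a b i j, C a b * C i j = C a j * C i b := fun a b i j => by
    simpa [adjForm_apply, hadj, hform_single, sub_eq_zero] using
      hform_det C (Pi.single a 1) (Pi.single i 1) (Pi.single b 1) (Pi.single j 1)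
  obtain ⟨i, j, hij⟩ : ∃ i j, C i j ≠ 0 := by
    by_contra! h0
    simp [(Matrix.ext h0 : C = 0)] at h
  have hvec : C = Matrix.vecMulVec (fun a => C a j) (fun b => C i b / C i j) := by
    ext a b
    rw [Matrix.vecMulVec_apply, mul_div_assoc', eq_div_iff hij, hminor]
  have hrank := Matrix.rank_vecMulVec_le (fun a => C a j) (fun b => C i b / C i j)
  rw [← hvec] at hrank
  lia

theorem two_le_rank_of_adjugate_ne_zero (h : C.adjugate ≠ 0) : 2 ≤ C.rank := by
  obtain ⟨i, j, hij⟩ : ∃ i j, C.adjugate i j ≠ 0 := by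
    by_contra! h0
    exact h (Matrix.ext h0)
  rw [Matrix.adjugate_fin_succ_eq_det_submatrix] at hij
  have hminor := Matrix.rank_of_det_ne_zero (right_ne_zero_of_mul hij)
  rw [Fintype.card_fin] at hminor
  exact hminor ▸ Matrix.rank_submatrix_le C j.succAbove i.succAbove

theorem two_le_rank_of_discr_ne_zero {v : C3} (h : discr C v ≠ 0) : 2 ≤ C.rank :=
  two_le_rank_of_adjugate_ne_zero fun h0 => h (by simp [discr, h0])

theorem exists_discr_homog_ne_zero (hC : C.IsHermitian) (hr : 2 ≤ C.rank) {z₀ : C2} {N : Set C2}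
    (hN : N ∈ 𝓝 z₀) : ∃ z ∈ N, discr C (homog k z) ≠ 0 := by
  by_contra! h
  have hform0 : ∀ᶠ v in 𝓝 (homog k z₀), adjForm C v v = 0 :=
    (eventually_eq_smul_homog k z₀ hN).mono fun v ⟨z, c, hv⟩ => by
      rw [← ofReal_discr hC, hv, discr_smul, h z z.2, mul_zero, Complex.ofReal_zero]
  have hadj : hform C.adjugateᵀ = 0 := eq_zero_of_eventually_apply_self_eq_zero hform0
  exact adjugate_ne_zero_of_two_le_rank hr
    (Matrix.transpose_eq_zero.1 (hform.map_eq_zero_iff.1 hadj))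

end Uniqueness

section Global

variable {C C' : Matrix (Fin 3) (Fin 3) ℂ} {g : BilinField} {U : Set CP2} {p : CP2}

theorem mk_mem_regularSet_iff (v : C3) (hv : v ≠ 0) :
    Projectivization.mk ℂ v hv ∈ regularSet C ↔ discr C v ≠ 0 := by
  have hl : v (index (Projectivization.mk ℂ v hv)) ≠ 0 :=
    (mk_mem_source_iff _ _ hv).1 (rep_index_ne_zero _)
  rw [regularSet, Set.mem_ofPred_eq, point, homog_affineChart_mk _ _ _ hl, discr_smul]
  simp [hl]

theorem isOpen_regularSet (C : Matrix (Fin 3) (Fin 3) ℂ) : IsOpen (regularSet C) := by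
  have hpre : (Projectivization.mk' ℂ : {v : C3 // v ≠ 0} → CP2) ⁻¹' regularSet C
      = {v | discr C v.1 ≠ 0} := Set.ext fun v => mk_mem_regularSet_iff v.1 v.2
  have hcont : Continuous fun v : C3 => discr C v := by
    unfold discr
    fun_prop
  rw [← isQuotientMap_mk.isOpen_preimage, hpre]
  exact isOpen_ne.preimage (hcont.comp continuous_subtype_val)

theorem inter_regularSet_nonempty (hC : C.IsHermitian) (hr : 2 ≤ C.rank) (hU : IsOpen U)
    (hne : U.Nonempty) : (U ∩ regularSet C).Nonempty := by
  obtain ⟨p, hp⟩ := hne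
  obtain ⟨k, z₀, rfl⟩ := exists_eq_affineChart_symm p
  obtain ⟨z, hzU, hz⟩ := exists_discr_homog_ne_zero hC hr ((isOpen_coordDomain k hU).mem_nhds hp)
  exact ⟨(affineChart k).symm z, hzU, (symm_mem_regularSet_iff C k z).2 hz⟩

theorem exists_isConnected_subset (hU : IsOpen U) (hne : U.Nonempty) :
    ∃ V ⊆ U, IsOpen V ∧ IsConnected V := by
  obtain ⟨p, hp⟩ := hne
  obtain ⟨k, z, rfl⟩ := exists_eq_affineChart_symm p
  obtain ⟨ε, hε, hball⟩ := Metric.isOpen_iff.1 (isOpen_coordDomain k hU) z hp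
  refine ⟨(affineChart k).symm '' Metric.ball z ε, Set.image_subset_iff.2 hball, ?_, ?_⟩
  · exact (affineChart k).symm.isOpen_image_of_subset_source Metric.isOpen_ball (Set.subset_univ _)
  · exact ((convex_ball z ε).isConnected ⟨z, Metric.mem_ball_self hε⟩).image _
      (continuous_affineChart_symm k).continuousOn

/-- `C` is a hermitian form with `g = g_C` near `p`; such a form is unique, and hence locally
constant in `p`. -/
def IsLocalForm (g : BilinField) (p : CP2) (C : Matrix (Fin 3) (Fin 3) ℂ) : Prop :=
  C.IsHermitian ∧ ∀ᶠ q in 𝓝 p, q ∈ regularSet C ∧ g q = metricOf C q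

theorem IsLocalForm.unique (h : IsLocalForm g p C) (h' : IsLocalForm g p C') : C = C' := by
  obtain ⟨k, z, rfl⟩ := exists_eq_affineChart_symm p
  have hcont := (continuous_affineChart_symm k).continuousAt (x := z)
  refine eq_of_inChart_metricOf_eq h.1 h'.1 (k := k) (z₀ := z) ?_
  filter_upwards [hcont.eventually h.2, hcont.eventually h'.2] with x hx hx'
  refine ⟨(symm_mem_regularSet_iff C k x).1 hx.1, fun u w => ?_⟩
  rw [inChart_eq, inChart_eq, ← hx.2, ← hx'.2]

theorem IsCompatibleMetric.exists_isLocalForm (hg : IsCompatibleMetric g U) (hU : IsOpen U)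
    (hp : p ∈ U) : ∃ C, IsLocalForm g p C := by
  have hsrc := rep_index_ne_zero p
  have hz₀ : affineChart (index p) p ∈ coordDomain U (index p) := by
    rwa [coordDomain, Set.mem_preimage, affineChart_symm_affineChart hsrc]
  obtain ⟨C, hC, h⟩ := hg.1.exists_metricOf_eq hU (isPlanar_of_equivalent hU hg.2) hz₀
  refine ⟨C, hC, ?_⟩
  filter_upwards [((affineChart (index p)).continuousAt hsrc).eventually h,
    (affineChart (index p)).open_source.mem_nhds hsrc] with q ⟨hdiscr, hq⟩ hqs
  rw [← affineChart_symm_affineChart hqs]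
  exact ⟨(symm_mem_regularSet_iff C _ _).2 hdiscr, eq_of_inChart_eq hq⟩

theorem IsCompatibleMetric.exists_forall_isLocalForm (hg : IsCompatibleMetric g U) (hU : IsOpen U)
    (hUc : IsConnected U) : ∃ C : Matrix (Fin 3) (Fin 3) ℂ, ∀ p ∈ U, IsLocalForm g p C := by
  choose F hF using fun p : U => hg.exists_isLocalForm hU p.2
  have hloc : IsLocallyConstant F := (IsLocallyConstant.iff_eventually_eq F).2 fun p => by
    filter_upwards [continuous_subtype_val.continuousAt.eventually (hF p).2.eventually_nhds]
      with q hq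
    exact (hF q).unique ⟨(hF p).1, hq⟩
  have : PreconnectedSpace U := Subtype.preconnectedSpace hUc.isPreconnected
  obtain ⟨p₀, hp₀⟩ := hUc.nonempty
  refine ⟨F ⟨p₀, hp₀⟩, fun p hp => ?_⟩
  rw [hloc.apply_eq_of_preconnectedSpace ⟨p₀, hp₀⟩ ⟨p, hp⟩]
  exact hF ⟨p, hp⟩

end Global

end CProj

end

theorem mainTheorem1 (U : Set CProj.CP2) (hU : IsOpen U) (hUc : IsConnected U) :
    (∀ C : Matrix (Fin 3) (Fin 3) ℂ, C.IsHermitian → 2 ≤ C.rank → U ⊆ CProj.regularSet C →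
      CProj.IsCompatibleMetric (CProj.metricOf C) U) ∧
    (∀ g : CProj.BilinField, CProj.IsCompatibleMetric g U →
      ∃! C : Matrix (Fin 3) (Fin 3) ℂ, C.IsHermitian ∧ 2 ≤ C.rank ∧ U ⊆ CProj.regularSet C ∧
        ∀ p ∈ U, g p = CProj.metricOf C p) ∧
    (∀ C : Matrix (Fin 3) (Fin 3) ℂ, C.IsHermitian → 2 ≤ C.rank →
      ∃ V : Set CProj.CP2, V ⊆ U ∧ V ⊆ CProj.regularSet C ∧ IsOpen V ∧ IsConnected V) := by
  obtain ⟨p₀, hp₀⟩ := hUc.nonempty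
  refine ⟨fun C hC _ hUC => CProj.isCompatibleMetric_metricOf hC hUC, fun g hg => ?_,
    fun C hC hr => ?_⟩
  · obtain ⟨C, h⟩ := hg.exists_forall_isLocalForm hU hUc
    refine ⟨C, ⟨(h p₀ hp₀).1, CProj.two_le_rank_of_discr_ne_zero (h p₀ hp₀).2.self_of_nhds.1,
      fun p hp => (h p hp).2.self_of_nhds.1, fun p hp => (h p hp).2.self_of_nhds.2⟩, ?_⟩
    rintro C' ⟨hC', -, hreg, heq⟩
    refine CProj.IsLocalForm.unique (g := g) (p := p₀) ⟨hC', ?_⟩ (h p₀ hp₀)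
    filter_upwards [hU.mem_nhds hp₀] with q hq
    exact ⟨hreg hq, heq q hq⟩
  · obtain ⟨V, hV, hVo, hVc⟩ := CProj.exists_isConnected_subset
      (hU.inter (CProj.isOpen_regularSet C)) (CProj.inter_regularSet_nonempty hC hr hU hUc.nonempty)
    exact ⟨V, fun p hp => (hV hp).1, fun p hp => (hV hp).2, hVo, hVc⟩
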